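/- Let $\alpha>0$ be fixed. Let $AP(\mathbb R)$ be the space of Bohr almost periodic functions, i.e. of continuous $f:\mathbb R\to\mathbb C$ such that for every $\varepsilon>0$ there is $L>0$ for which every interval of length greater than $L$ contains some $\tau$ with $\sup_t|f(t+\tau)-f(t)|\le\varepsilon$; put $$(f,g)_{AP}=\lim_{T\to+\infty}\frac1{2T}\int_{-T}^{T}f(t)\overline{g(t)}\,dt,\qquad \|f\|_{AP}=(f,f)_{AP}^{1/2}.$$ Let $AP(\mathbb Z)$ be the space of almost periodic sequences, i.e. of $a:\mathbb Z\to\mathbb C$ such that for every $\varepsilon>0$ there is $N\in\mathbb N$ for which every set of $N$ consecutive integers contains some $p$ with $\sup_{n\in\mathbb Z}|a_{n+p}-a_n|\le\varepsilon$; put $$(a,b)_{AP(\mathbb Z)}=\lim_{p\to+\infty}\frac1{2p}\sum_{n=-p}^{p}a_n\overline{b_n},\qquad \|a\|_{AP(\mathbb Z)}=(a,a)_{AP(\mathbb Z)}^{1/2}.$$ For $\psi\in L^1(\mathbb R)$ write $\widehat\psi(\lambda)=\int_{\mathbb R}\psi(t)e^{-i\lambda t}\,dt$, $T_x\psi(t)=\psi(t-x)$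 and $\langle f,\psi\rangle=\int_{\mathbb R}f(t)\overline{\psi(t)}\,dt$. Let $W$ be the Wiener space of all $\psi\in L^\infty(\mathbb R)$ with $\sum_{k\in\mathbb Z}\operatorname{ess\,sup}_{x\in[0,1]}|\psi(x-k)|<\infty$ (so that $W\subset L^1(\mathbb R)$), and let $\widehat W=\{\widehat\varphi:\varphi\in W\}$, where functions that agree almost everywhere are identified. **Proposition.** The limits that define the two inner products exist for all elements of $AP(\mathbb R)$ and of $AP(\mathbb Z)$, respectively. Let $\psi\in L^1(\mathbb R)$. For every $f\in AP(\mathbb R)$ the sequence $Sf=(\langle f,T_{k\alpha}\psi\rangle)_{k\in\mathbb Z}$ belongs to $AP(\mathbb Z)$, and the map $$S:(AP(\mathbb R),\|\cdot\|_{AP})\to(AP(\mathbb Z),\|\cdot\|_{AP(\mathbb Z)}),\qquad f\mapsto(\langle f,T_{k\alpha}\psi\rangle)_{k\in\mathbb Z},$$ is continuous if and only if $$\sup_{\lambda\in\mathbb R}\ \sum_{k\in\mathbb Z}\Bigl|\widehat\psi\Bigl(\lambda+2\pi\frac k\alpha\Bigr)\Bigr|^2<\infty.$$ In particular, $S$ is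 continuous if $\psi\in W$ or if $\psi\in L^1(\mathbb R)\cap\widehat W$. -/

import Mathlib

open MeasureTheory Filter Topology

noncomputable section

namespace AlmostPeriodic

/-- The space `AP(ℝ)` of almost periodic functions in the sense of Bohr, as a set of functions. Every
interval contains the open interval with the same end points, so it is enough to speak of those. -/
def APReal : Set (ℝ → ℂ) :=
  {f | Continuous f ∧ ∀ ε : ℝ, 0 < ε → ∃ L : ℝ, 0 < L ∧ ∀ a b : ℝ, L < b - a →
    ∃ τ ∈ Set.Ioo a b, ∀ t : ℝ, ‖f (t + τ) - f t‖ ≤ ε}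

/-- The space `AP(ℤ)` of almost periodic sequences: every set `{m, …, m + N - 1}` of `N` consecutive
integers contains an `ε`-almost period. -/
def APInt : Set (ℤ → ℂ) :=
  {a | ∀ ε : ℝ, 0 < ε → ∃ N : ℕ, ∀ m : ℤ, ∃ p ∈ Set.Ico m (m + N),
    ∀ n : ℤ, ‖a (n + p) - a n‖ ≤ ε}

/-- `(2T)⁻¹ ∫_{-T}^{T} f(t) conj(g(t)) dt`. -/
def meanReal (f g : ℝ → ℂ) (T : ℝ) : ℂ :=
  (2 * (T : ℂ))⁻¹ * ∫ t in (-T)..T, f t * starRingEnd ℂ (g t)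

/-- The inner product `(f, g)_AP`, the limit of the means as `T → ∞`. -/
def innerReal (f g : ℝ → ℂ) : ℂ := limUnder atTop (meanReal f g)

/-- The norm `‖f‖_AP`. -/
def normReal (f : ℝ → ℂ) : ℝ := √(innerReal f f).re

/-- `(2p)⁻¹ ∑_{n=-p}^{p} a_n conj(b_n)`. -/
def meanInt (a b : ℤ → ℂ) (p : ℕ) : ℂ :=
  (2 * (p : ℂ))⁻¹ * ∑ n ∈ Finset.Icc (-(p : ℤ)) (p : ℤ), a n * starRingEnd ℂ (b n)

/-- The inner product `(a, b)_{AP(ℤ)}`, the limit of the means as `p → ∞`. -/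
def innerInt (a b : ℤ → ℂ) : ℂ := limUnder atTop (meanInt a b)

/-- The norm `‖a‖_{AP(ℤ)}`. -/
def normInt (a : ℤ → ℂ) : ℝ := √(innerInt a a).re

/-- The translate `T_x ψ (t) = ψ (t - x)`. -/
def translate (x : ℝ) (ψ : ℝ → ℂ) : ℝ → ℂ := fun t => ψ (t - x)

/-- The duality `⟨f, g⟩ = ∫ f(t) conj(g(t)) dt`. -/
def pairing (f g : ℝ → ℂ) : ℂ := ∫ t : ℝ, f t * starRingEnd ℂ (g t)

/-- The analysis map `S f = (⟨f, T_{kα} ψ⟩)_k`. -/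
def analysis (α : ℝ) (ψ f : ℝ → ℂ) : ℤ → ℂ := fun k => pairing f (translate (k * α) ψ)

/-- Continuity of `S : (AP(ℝ), ‖·‖_AP) → (AP(ℤ), ‖·‖_{AP(ℤ)})`: at every point `f` of `AP(ℝ)`, with
respect to the metrics given by the two norms. -/
def AnalysisContinuous (α : ℝ) (ψ : ℝ → ℂ) : Prop :=
  ∀ f ∈ APReal, ∀ ε : ℝ, 0 < ε → ∃ δ : ℝ, 0 < δ ∧ ∀ g ∈ APReal,
    normReal (g - f) < δ → normInt (analysis α ψ g - analysis α ψ f) < ε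

/-- The Fourier transform `∫ f(t) e^{-iξt} dt`. -/
def fourierT (f : ℝ → ℂ) (ξ : ℝ) : ℂ :=
  ∫ t : ℝ, f t * Complex.exp (-(Complex.I * ξ * t))

/-- The Wiener space `W`. -/
def MemW (ψ : ℝ → ℂ) : Prop :=
  MemLp ψ ⊤ volume ∧
    (∑' k : ℤ, essSup (fun x : ℝ => ‖ψ (x - k)‖ₑ) (volume.restrict (Set.Icc (0 : ℝ) 1))) < ⊤

/-- The space of (almost everywhere classes of) Fourier transforms of elements of `W`. -/
def MemWHat (ψ : ℝ → ℂ) : Prop :=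
  ∃ φ : ℝ → ℂ, MemW φ ∧ ψ =ᵐ[volume] fourierT φ

end AlmostPeriodic

end

/-!
The continuity of the analysis map `S` is reduced to the Bessel property of the translates
`T_{kα} ψ`, that is, to an inequality `∑ₖ |⟨u, T_{kα} ψ⟩|² ≤ B ‖u‖₂²` for bounded square integrable
`u` (`IsBesselBound`). No approximation of almost periodic functions by trigonometric polynomials is
needed.

*Almost periodicity and means.* Bohr's condition is equivalent, for continuous functions on `ℝ` and for
sequences on `ℤ`, to Bochner's: the translates are totally bounded in the uniform distance
(`FiniteTranslates`). This form is visibly stable under sums, products and pull-back along `k ↦ kα`,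
whence `S` maps `AP(ℝ)` to `AP(ℤ)`. It also yields the mean values: if `A` and `B` are two averaging
operators that are nearly invariant under translation, then the double average of `h (s + t)` is close
to `A h` and, by Fubini, to `B h` (`exists_tendsto_integral_of_finiteTranslates`).

*A Bessel bound implies continuity.* Truncate `f` to `[-(p + R)α, (p + R)α]` and apply the Bessel
inequality. Up to the tail of `ψ` beyond `Rα`, this bounds `∑_{|k| ≤ p} |S f (k)|²` by a multiple of
`∫ |f|²` over that interval. Dividing by `2p` and letting `p → ∞`, then `R → ∞`, gives
`‖S f‖² ≤ 2 B α ‖f‖²` (`innerInt_analysis_le`).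

*The Fourier condition implies a Bessel bound.* By duality the Bessel bound is a bound for
`‖∑ cₖ T_{kα} ψ‖₂`. The Fourier transform of this sum is a trigonometric sum of period `2π / α` times
`ψ̂`; folding the frequency line onto one period produces `∑ₖ |ψ̂(λ + 2πk/α)|²`, and Plancherel's
identity concludes (`lintegral_sum_translate_sq_le`). Since `ψ` is only assumed integrable, this
needs the fact that an integrable function whose transform is square integrable is itself square
integrable (`eLpNorm_two_eq_of_memLp_fourier`).

*Necessity.* If `f = ∑ ψ̂(λₖ) exp(iλₖt)` over finitely many `λₖ` in a coset of `2πℤ/α`, then `S f` is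
a multiple of one character, `‖f‖² = s` and `‖S f‖ = s` with `s = ∑ |ψ̂(λₖ)|²`; continuity at `0`
therefore bounds `s` (`iSup_lt_top_of_analysisContinuous`).

*The Wiener space.* A function of `W` is dominated by a step function with summable values, and so the
sums of its absolute value over translated lattices are bounded (`exists_tsum_floor_le`). For
`ψ ∈ W` Schur's test gives a Bessel bound; for the transform of an element of `W` Fourier inversion
gives the Fourier condition.
-/

/-! ### Functions with finitely many translates up to `ε` -/

namespace AlmostPeriodic

/-- Bochner's form of almost periodicity: the translates of `f` are totally bounded in the uniform
distance. It is encoded by colourings of the group with finitely many colours such that translates by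
elements of the same colour are uniformly `ε`-close. -/
def FiniteTranslates {G : Type*} [Add G] (f : G → ℂ) : Prop :=
  ∀ ε : ℝ, 0 < ε → ∃ (ι : Type) (_ : Finite ι) (c : G → ι),
    ∀ s s', c s = c s' → ∀ t, ‖f (t + s) - f (t + s')‖ ≤ ε

namespace FiniteTranslates

variable {G : Type*} {f g : G → ℂ}

/-- A representative of each colour gives a finite `ε`-net among the translates. -/
theorem exists_finset [Add G] (hf : FiniteTranslates f) {ε : ℝ} (hε : 0 < ε) :
    ∃ F : Finset G, ∀ s, ∃ s' ∈ F, ∀ t, ‖f (t + s) - f (t + s')‖ ≤ ε := by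
  classical
  obtain ⟨ι, hι, c, hc⟩ := hf ε hε
  have hfin : (Set.range c).Finite := Set.toFinite _
  choose r hr using fun i : Set.range c => i.2
  have : Finite (Set.range c) := hfin
  cases nonempty_fintype (Set.range c)
  refine ⟨Finset.univ.image r, fun s => ⟨r ⟨c s, s, rfl⟩, by simp, fun t => hc _ _ ?_ t⟩⟩
  exact (hr ⟨c s, s, rfl⟩).symm

theorem bounded [AddCommGroup G] (hf : FiniteTranslates f) : ∃ B : ℝ, 0 < B ∧ ∀ t, ‖f t‖ ≤ B := by
  obtain ⟨F, hF⟩ := hf.exists_finset one_pos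
  refine ⟨(∑ s ∈ F, ‖f s‖) + 1, by positivity, fun t => ?_⟩
  obtain ⟨s, hs, h⟩ := hF t
  have h0 := h 0
  simp only [zero_add] at h0
  have h1 : ‖f s‖ ≤ ∑ s ∈ F, ‖f s‖ :=
    Finset.single_le_sum (f := fun s => ‖f s‖) (fun _ _ => norm_nonneg _) hs
  have := norm_le_norm_add_norm_sub' (f t) (f s)
  linarith

theorem add [Add G] (hf : FiniteTranslates f) (hg : FiniteTranslates g) :
    FiniteTranslates (f + g) := by
  intro ε hε
  obtain ⟨ι, hι, c, hc⟩ := hf (ε / 2) (by positivity)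
  obtain ⟨κ, hκ, d, hd⟩ := hg (ε / 2) (by positivity)
  refine ⟨ι × κ, inferInstance, fun s => (c s, d s), fun s s' h t => ?_⟩
  obtain ⟨h1, h2⟩ := Prod.mk.inj h
  have e : (f + g) (t + s) - (f + g) (t + s')
      = (f (t + s) - f (t + s')) + (g (t + s) - g (t + s')) := by
    simp only [Pi.add_apply]; ring
  rw [e]
  linarith [norm_add_le (f (t + s) - f (t + s')) (g (t + s) - g (t + s')), hc _ _ h1 t, hd _ _ h2 t]

theorem conj [Add G] (hf : FiniteTranslates f) :
    FiniteTranslates fun t => starRingEnd ℂ (f t) := by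
  intro ε hε
  obtain ⟨ι, hι, c, hc⟩ := hf ε hε
  exact ⟨ι, hι, c, fun s s' h t => by simpa only [← map_sub, RCLike.norm_conj] using hc s s' h t⟩

theorem mul [AddCommGroup G] (hf : FiniteTranslates f) (hg : FiniteTranslates g) :
    FiniteTranslates fun t => f t * g t := by
  intro ε hε
  obtain ⟨A, hA, hfA⟩ := hf.bounded
  obtain ⟨B, hB, hgB⟩ := hg.bounded
  obtain ⟨ι, hι, c, hc⟩ := hf (ε / (2 * B)) (by positivity)
  obtain ⟨κ, hκ, d, hd⟩ := hg (ε / (2 * A)) (by positivity)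
  refine ⟨ι × κ, inferInstance, fun s => (c s, d s), fun s s' h t => ?_⟩
  obtain ⟨h1, h2⟩ := Prod.mk.inj h
  have e : f (t + s) * g (t + s) - f (t + s') * g (t + s')
      = (f (t + s) - f (t + s')) * g (t + s) + f (t + s') * (g (t + s) - g (t + s')) := by ring
  rw [e]
  calc _ ≤ ‖f (t + s) - f (t + s')‖ * ‖g (t + s)‖ + ‖f (t + s')‖ * ‖g (t + s) - g (t + s')‖ := by
        simpa only [norm_mul] using norm_add_le ((f (t + s) - f (t + s')) * g (t + s))
          (f (t + s') * (g (t + s) - g (t + s')))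
    _ ≤ ε / (2 * B) * B + A * (ε / (2 * A)) := by
        gcongr
        · exact hc _ _ h1 t
        · exact hgB _
        · exact hfA _
        · exact hd _ _ h2 t
    _ = ε := by field_simp; norm_num

end FiniteTranslates

/-! ### Bohr's definition and Bochner's -/

theorem uniformContinuous_of_mem_APReal {f : ℝ → ℂ} (hf : f ∈ APReal) : UniformContinuous f := by
  obtain ⟨hc, hp⟩ := hf
  rw [Metric.uniformContinuous_iff]
  intro ε hε
  obtain ⟨L, hL, hτ⟩ := hp (ε / 4) (by positivity)
  have huc : UniformContinuousOn f (Set.Icc (-1) (L + 2)) :=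
    isCompact_Icc.uniformContinuousOn_of_continuous hc.continuousOn
  obtain ⟨δ, hδ, h⟩ := Metric.uniformContinuousOn_iff.1 huc (ε / 4) (by positivity)
  refine ⟨min δ 1, by positivity, fun {a b} hab => ?_⟩
  -- An almost period carries `a` into `[0, L + 1]`, hence `b` into `[-1, L + 2]`.
  obtain ⟨τ, ⟨h1, h2⟩, h3⟩ := hτ (-a) (L + 1 - a) (by linarith)
  have hab' := abs_lt.1 (lt_of_lt_of_le hab (min_le_right _ _))
  have hd := h (a + τ) ⟨by linarith, by linarith⟩ (b + τ) ⟨by linarith, by linarith⟩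
    (by rw [dist_add_right]; exact lt_of_lt_of_le hab (min_le_left _ _))
  have ha := h3 a
  have hb := h3 b
  rw [← dist_eq_norm] at ha hb
  rw [dist_comm] at ha
  linarith [dist_triangle4 (f a) (f (a + τ)) (f (b + τ)) (f b)]

theorem finiteTranslates_of_mem_APReal {f : ℝ → ℂ} (hf : f ∈ APReal) : FiniteTranslates f := by
  intro ε hε
  obtain ⟨δ, hδ, hu⟩ := Metric.uniformContinuous_iff.1 (uniformContinuous_of_mem_APReal hf) (ε / 3)
    (by positivity)
  obtain ⟨L, hL, hτ⟩ := hf.2 (ε / 3) (by positivity)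
  choose τ hτm hτp using fun s : ℝ => hτ (s - (L + 1)) s (by linarith)
  -- The colour of `s` is the cell of length `δ` in which `s - τ s ∈ (0, L + 1)` lies.
  have hlt (s : ℝ) : ⌊(s - τ s) / δ⌋₊ < ⌊(L + 1) / δ⌋₊ + 1 := by
    have := (hτm s).1
    exact Nat.lt_succ_of_le (Nat.floor_le_floor (by gcongr; linarith))
  refine ⟨Fin (⌊(L + 1) / δ⌋₊ + 1), inferInstance, fun s => ⟨⌊(s - τ s) / δ⌋₊, hlt s⟩,
    fun s s' h t => ?_⟩
  have h' : ⌊(s - τ s) / δ⌋₊ = ⌊(s' - τ s') / δ⌋₊ := Fin.mk.inj h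
  have hp (r : ℝ) : 0 ≤ (r - τ r) / δ := div_nonneg (by linarith [(hτm r).2]) hδ.le
  have hd : |(s - τ s) - (s' - τ s')| < δ := by
    have a1 := Nat.floor_le (hp s)
    have a2 := Nat.lt_floor_add_one ((s - τ s) / δ)
    have b1 := Nat.floor_le (hp s')
    have b2 := Nat.lt_floor_add_one ((s' - τ s') / δ)
    rw [h'] at a1 a2
    have : |(s - τ s) / δ - (s' - τ s') / δ| < 1 := abs_lt.2 ⟨by linarith, by linarith⟩
    rwa [← sub_div, abs_div, abs_of_pos hδ, div_lt_one hδ] at this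
  have e1 := hτp s (t + (s - τ s))
  have e2 := hτp s' (t + (s' - τ s'))
  have e3 := hu (a := t + (s - τ s)) (b := t + (s' - τ s')) (by rwa [dist_add_left, Real.dist_eq])
  rw [show t + (s - τ s) + τ s = t + s by ring] at e1
  rw [show t + (s' - τ s') + τ s' = t + s' by ring] at e2
  rw [← dist_eq_norm] at e1 e2 ⊢
  rw [dist_comm] at e2
  linarith [dist_triangle4 (f (t + s)) (f (t + (s - τ s))) (f (t + (s' - τ s'))) (f (t + s'))]

theorem finiteTranslates_of_mem_APInt {a : ℤ → ℂ} (ha : a ∈ APInt) : FiniteTranslates a := by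
  intro ε hε
  obtain ⟨N, hN⟩ := ha (ε / 2) (by positivity)
  choose p hpm hpp using fun s : ℤ => hN (s - N + 1)
  have hr (s : ℤ) : 0 ≤ s - p s ∧ s - p s < N := by
    have := Set.mem_Ico.1 (hpm s); omega
  refine ⟨Fin N, inferInstance, fun s => ⟨(s - p s).toNat, by have := hr s; omega⟩,
    fun s s' h t => ?_⟩
  have h' : (s - p s).toNat = (s' - p s').toNat := Fin.mk.inj h
  have h'' : s - p s = s' - p s' := by have := hr s; have := hr s'; omega
  have e1 := hpp s (t + (s - p s))
  have e2 := hpp s' (t + (s' - p s'))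
  rw [show t + (s - p s) + p s = t + s by ring, h''] at e1
  rw [show t + (s' - p s') + p s' = t + s' by ring] at e2
  rw [← dist_eq_norm] at e1 e2 ⊢
  linarith [dist_triangle_right (a (t + s)) (a (t + s')) (a (t + (s' - p s')))]

theorem mem_APReal_of_finiteTranslates {f : ℝ → ℂ} (hc : Continuous f) (hf : FiniteTranslates f) :
    f ∈ APReal := by
  refine ⟨hc, fun ε hε => ?_⟩
  obtain ⟨F, hF⟩ := hf.exists_finset hε
  obtain ⟨M, hM⟩ := (F.finite_toSet.isBounded).exists_norm_le
  have hM0 : 0 ≤ M := by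
    obtain ⟨s, hs, -⟩ := hF 0
    exact (norm_nonneg s).trans (hM s hs)
  refine ⟨2 * M + 1, by positivity, fun a b hab => ?_⟩
  obtain ⟨s, hs, h⟩ := hF ((a + b) / 2)
  have hs' := abs_le.1 (hM s hs)
  refine ⟨(a + b) / 2 - s, ⟨by linarith, by linarith⟩, fun t => ?_⟩
  have := h (t - s)
  rwa [show t - s + (a + b) / 2 = t + ((a + b) / 2 - s) by ring, sub_add_cancel] at this

theorem mem_APInt_of_finiteTranslates {a : ℤ → ℂ} (ha : FiniteTranslates a) : a ∈ APInt := by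
  intro ε hε
  obtain ⟨F, hF⟩ := ha.exists_finset hε
  obtain ⟨M, hM⟩ : ∃ M : ℕ, ∀ s ∈ F, s.natAbs ≤ M :=
    ⟨F.sup Int.natAbs, fun s hs => Finset.le_sup (f := Int.natAbs) hs⟩
  refine ⟨2 * M + 1, fun m => ?_⟩
  obtain ⟨s, hs, h⟩ := hF (m + M)
  have := hM s hs
  refine ⟨m + M - s, ⟨by omega, by push_cast; omega⟩, fun n => ?_⟩
  have := h (n - s)
  rwa [show n - s + (m + M) = n + (m + M - s) by ring, sub_add_cancel] at this

theorem add_mem_APReal {f g : ℝ → ℂ} (hf : f ∈ APReal) (hg : g ∈ APReal) : f + g ∈ APReal :=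
  mem_APReal_of_finiteTranslates (hf.1.add hg.1)
    ((finiteTranslates_of_mem_APReal hf).add (finiteTranslates_of_mem_APReal hg))

theorem const_mem_APReal (c : ℂ) : (fun _ => c) ∈ APReal :=
  ⟨continuous_const, fun _ hε => ⟨1, one_pos, fun a b _ =>
    ⟨(a + b) / 2, ⟨by linarith, by linarith⟩, fun _ => by simpa using hε.le⟩⟩⟩

theorem mul_mem_APReal {f g : ℝ → ℂ} (hf : f ∈ APReal) (hg : g ∈ APReal) :
    (fun t => f t * g t) ∈ APReal :=
  mem_APReal_of_finiteTranslates (hf.1.mul hg.1)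
    ((finiteTranslates_of_mem_APReal hf).mul (finiteTranslates_of_mem_APReal hg))

theorem sub_mem_APReal {f g : ℝ → ℂ} (hf : f ∈ APReal) (hg : g ∈ APReal) : f - g ∈ APReal := by
  have := add_mem_APReal hf (mul_mem_APReal (const_mem_APReal (-1)) hg)
  convert this using 1
  ext t; simp [sub_eq_add_neg]

theorem sum_mem_APReal {ι : Type*} (F : Finset ι) {f : ι → ℝ → ℂ} (hf : ∀ i ∈ F, f i ∈ APReal) :
    (fun t => ∑ i ∈ F, f i t) ∈ APReal := by
  classical
  induction F using Finset.induction_on with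
  | empty => simpa using const_mem_APReal 0
  | insert i F hi ih =>
    simp only [Finset.sum_insert hi]
    exact add_mem_APReal (hf i (Finset.mem_insert_self _ _))
      (ih fun j hj => hf j (Finset.mem_insert_of_mem hj))

theorem mem_APReal_of_periodic {f : ℝ → ℂ} (hc : Continuous f) {P : ℝ} (hP : 0 < P)
    (hf : Function.Periodic f P) : f ∈ APReal := by
  refine ⟨hc, fun ε hε => ⟨P, hP, fun a b hab => ?_⟩⟩
  obtain ⟨n, ⟨h1, h2⟩, -⟩ := existsUnique_add_zsmul_mem_Ioc hP 0 a
  rw [zero_add] at h1 h2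
  refine ⟨n • P, ⟨h1, by linarith⟩, fun t => ?_⟩
  rw [(hf.zsmul n) t, sub_self, norm_zero]
  exact hε.le

theorem exp_mem_APReal (ξ : ℝ) : (fun t : ℝ => Complex.exp (Complex.I * ξ * t)) ∈ APReal := by
  rcases eq_or_ne ξ 0 with rfl | hξ
  · simpa using const_mem_APReal 1
  refine mem_APReal_of_periodic (by fun_prop) (P := 2 * Real.pi / |ξ|)
    (by have := Real.pi_pos; positivity) fun t => ?_
  rcases abs_cases ξ with ⟨h, -⟩ | ⟨h, -⟩ <;> rw [h] <;> push_cast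
  · rw [← Complex.exp_periodic (Complex.I * ξ * t)]
    congr 1
    have : (ξ : ℂ) ≠ 0 := by exact_mod_cast hξ
    field_simp
  · rw [← Complex.exp_periodic.sub_eq (Complex.I * ξ * t)]
    congr 1
    have : (ξ : ℂ) ≠ 0 := by exact_mod_cast hξ
    field_simp
    ring

end AlmostPeriodic

/-! ### Existence of the mean values -/

namespace AlmostPeriodic

/-- A function with finitely many translates up to `ε` has a mean along every asymptotically
translation invariant family of probability measures. All translates have nearly the same mean with
respect to `ν i`, so the double mean `∬ h (s + t) dν i dν j` is close to the mean with respect to `ν i`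
as well as to that with respect to `ν j`: the means form a Cauchy family. -/
theorem exists_tendsto_integral_of_finiteTranslates {G ι : Type*} [AddCommGroup G]
    [MeasurableSpace G] [MeasurableAdd₂ G] {l : Filter ι} [l.NeBot] {ν : ι → Measure G}
    (hν : ∀ᶠ i in l, IsProbabilityMeasure (ν i)) {h : G → ℂ} (hm : Measurable h)
    (hh : FiniteTranslates h)
    (hinv : ∀ s, Tendsto (fun i => ∫ t, h (t + s) ∂ν i - ∫ t, h t ∂ν i) l (𝓝 0)) :
    ∃ c, Tendsto (fun i => ∫ t, h t ∂ν i) l (𝓝 c) := by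
  obtain ⟨B, hB, hhB⟩ := hh.bounded
  have hint (μ : Measure G) [IsProbabilityMeasure μ] (s : G) : Integrable (fun t => h (t + s)) μ :=
    Integrable.of_bound (hm.comp (measurable_add_const s)).aestronglyMeasurable B
      (Eventually.of_forall fun t => hhB _)
  have unif (ε : ℝ) (hε : 0 < ε) : ∀ᶠ i in l, IsProbabilityMeasure (ν i) ∧
      ∀ s, ‖∫ t, h (t + s) ∂ν i - ∫ t, h t ∂ν i‖ ≤ 2 * ε := by
    obtain ⟨F, hF⟩ := hh.exists_finset hε
    have hF' : ∀ᶠ i in l, ∀ s ∈ F, ‖∫ t, h (t + s) ∂ν i - ∫ t, h t ∂ν i‖ < ε :=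
      (Finset.eventually_all F).2 fun s _ => by
        simpa using (hinv s).norm.eventually (gt_mem_nhds (by simpa using hε))
    filter_upwards [hν, hF'] with i hi hi'
    refine ⟨hi, fun s => ?_⟩
    obtain ⟨s', hs', hss⟩ := hF s
    have h1 : ‖∫ t, h (t + s) ∂ν i - ∫ t, h (t + s') ∂ν i‖ ≤ ε := by
      rw [← integral_sub (hint _ s) (hint _ s')]
      simpa using norm_integral_le_of_norm_le_const (μ := ν i) (Eventually.of_forall hss)
    have h2 := hi' s' hs'
    rw [← dist_eq_norm] at h1 h2 ⊢
    linarith [dist_triangle (∫ t, h (t + s) ∂ν i) (∫ t, h (t + s') ∂ν i) (∫ t, h t ∂ν i)]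
  have double (μ ρ : Measure G) [IsProbabilityMeasure μ] [IsProbabilityMeasure ρ] (δ : ℝ)
      (hμ : ∀ s, ‖∫ t, h (t + s) ∂μ - ∫ t, h t ∂μ‖ ≤ δ) :
      ‖∫ s, ∫ t, h (t + s) ∂μ ∂ρ - ∫ t, h t ∂μ‖ ≤ δ := by
    have hi : Integrable (fun s => ∫ t, h (t + s) ∂μ) ρ := by
      refine Integrable.of_bound ?_ B (Eventually.of_forall fun s => ?_)
      · exact (StronglyMeasurable.integral_prod_left (f := fun t s => h (t + s))
          (by have : Measurable (Function.uncurry fun t s => h (t + s)) := by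
                exact hm.comp measurable_add
              exact this.stronglyMeasurable)).aestronglyMeasurable
      · simpa using norm_integral_le_of_norm_le_const (μ := μ)
          (Eventually.of_forall fun t => hhB (t + s))
    have : ∫ s, (∫ t, h (t + s) ∂μ - ∫ t, h t ∂μ) ∂ρ
        = ∫ s, ∫ t, h (t + s) ∂μ ∂ρ - ∫ t, h t ∂μ := by
      rw [integral_sub hi (integrable_const _)]; simp
    rw [← this]
    simpa using norm_integral_le_of_norm_le_const (μ := ρ) (Eventually.of_forall hμ)
  have hC : Cauchy (map (fun i => ∫ t, h t ∂ν i) l) := by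
    rw [Metric.cauchy_iff]
    refine ⟨inferInstance, fun ε hε => ?_⟩
    have hU := unif (ε / 6) (by positivity)
    refine ⟨_, image_mem_map hU, ?_⟩
    rintro _ ⟨i, ⟨hi, hi'⟩, rfl⟩ _ ⟨j, ⟨hj, hj'⟩, rfl⟩
    have h1 := double (ν i) (ν j) _ hi'
    have h2 := double (ν j) (ν i) _ hj'
    have hsw : ∫ s, ∫ t, h (t + s) ∂ν i ∂ν j = ∫ s, ∫ t, h (t + s) ∂ν j ∂ν i := by
      rw [integral_integral_swap]
      · simp only [add_comm]
      · exact Integrable.of_bound (by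
          have : Measurable (Function.uncurry fun s t => h (t + s)) :=
            hm.comp (measurable_snd.add measurable_fst)
          exact this.aestronglyMeasurable) B (Eventually.of_forall fun t => hhB _)
    rw [hsw] at h1
    rw [← dist_eq_norm] at h1 h2
    have := dist_triangle_left (∫ t, h t ∂ν i) (∫ t, h t ∂ν j) (∫ s, ∫ t, h (t + s) ∂ν j ∂ν i)
    linarith
  exact cauchy_map_iff_exists_tendsto.1 hC

theorem integral_cond_Ioc (h : ℝ → ℂ) {T : ℝ} (hT : 0 < T) :
    ∫ t, h t ∂(ProbabilityTheory.cond volume (Set.Ioc (-T) T))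
      = (2 * (T : ℂ))⁻¹ * ∫ t in (-T)..T, h t := by
  rw [ProbabilityTheory.cond, integral_smul_measure, Real.volume_Ioc,
    intervalIntegral.integral_of_le (by linarith), show T - -T = 2 * T by ring,
    ENNReal.toReal_inv, ENNReal.toReal_ofReal (by positivity), Complex.real_smul]
  push_cast
  rfl

theorem exists_tendsto_mean_real {h : ℝ → ℂ} (hc : Continuous h) (hh : FiniteTranslates h) :
    ∃ c, Tendsto (fun T : ℝ => (2 * (T : ℂ))⁻¹ * ∫ t in (-T)..T, h t) atTop (𝓝 c) := by
  obtain ⟨B, hB, hhB⟩ := hh.bounded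
  have key := exists_tendsto_integral_of_finiteTranslates (l := atTop) (h := h)
    (ν := fun T : ℝ => ProbabilityTheory.cond volume (Set.Ioc (-T) T)) ?_ hc.measurable hh ?_
  · obtain ⟨c, hc⟩ := key
    refine ⟨c, hc.congr' ?_⟩
    filter_upwards [eventually_gt_atTop 0] with T hT using integral_cond_Ioc h hT
  · filter_upwards [eventually_gt_atTop 0] with T hT
    refine ProbabilityTheory.cond_isProbabilityMeasure_of_finite ?_ ?_
    · rw [Real.volume_Ioc]; simpa using by linarith
    · rw [Real.volume_Ioc]; exact ENNReal.ofReal_ne_top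
  · intro s
    rw [tendsto_zero_iff_norm_tendsto_zero]
    have hlim : Tendsto (fun T : ℝ => (2 * T)⁻¹ * (2 * (B * |s|))) atTop (𝓝 0) := by
      simpa using ((tendsto_id.const_mul_atTop (two_pos (α := ℝ))).inv_tendsto_atTop).mul_const
        (2 * (B * |s|))
    refine squeeze_zero' (Eventually.of_forall fun _ => norm_nonneg _) ?_ hlim
    filter_upwards [eventually_gt_atTop 0] with T hT
    rw [integral_cond_Ioc (fun t => h (t + s)) hT, integral_cond_Ioc h hT, ← mul_sub, norm_mul]
    have hn : ‖(2 * (T : ℂ))⁻¹‖ = (2 * T)⁻¹ := by simp [abs_of_pos hT]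
    rw [hn, intervalIntegral.integral_comp_add_right,
      intervalIntegral.integral_interval_sub_interval_comm (hc.intervalIntegrable _ _)
        (hc.intervalIntegrable _ _) (hc.intervalIntegrable _ _)]
    refine mul_le_mul_of_nonneg_left ?_ (by positivity)
    have b1 := intervalIntegral.norm_integral_le_of_norm_le_const (f := h) (C := B)
      (a := -T + s) (b := -T) fun t _ => hhB t
    have b2 := intervalIntegral.norm_integral_le_of_norm_le_const (f := h) (C := B)
      (a := T + s) (b := T) fun t _ => hhB t
    rw [show -T - (-T + s) = -s by ring, abs_neg] at b1
    rw [show T - (T + s) = -s by ring, abs_neg] at b2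
    linarith [norm_sub_le (∫ t in (-T + s)..(-T), h t) (∫ t in (T + s)..T, h t)]

theorem integral_cond_Icc (a : ℤ → ℂ) (p : ℕ) :
    ∫ n, a n ∂(ProbabilityTheory.cond Measure.count (Finset.Icc (-(p : ℤ)) p : Set ℤ))
      = (2 * (p : ℂ) + 1)⁻¹ * ∑ n ∈ Finset.Icc (-(p : ℤ)) p, a n := by
  have hi : IntegrableOn a (Finset.Icc (-(p : ℤ)) p : Set ℤ) Measure.count := by
    rw [IntegrableOn]
    have : IsFiniteMeasure ((Measure.count : Measure ℤ).restrict (Finset.Icc (-(p : ℤ)) p)) :=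
      ⟨by simp⟩
    refine Integrable.of_bound (C := ∑ n ∈ Finset.Icc (-(p : ℤ)) p, ‖a n‖)
      (measurable_of_countable a).aestronglyMeasurable ?_
    refine (ae_restrict_iff' (Finset.measurableSet _)).2 (Eventually.of_forall fun n hn => ?_)
    exact Finset.single_le_sum (f := fun n => ‖a n‖) (fun _ _ => norm_nonneg _) hn
  rw [ProbabilityTheory.cond, integral_smul_measure, Measure.count_apply_finset,
    setIntegral_finset _ hi]
  simp only [measureReal_def, Measure.count_singleton, ENNReal.toReal_one, one_smul,
    ENNReal.toReal_inv, ENNReal.toReal_natCast, Int.card_Icc, Complex.real_smul]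
  congr 1
  rw [show ((p : ℤ) + 1 - -(p : ℤ)).toNat = 2 * p + 1 by omega]
  push_cast
  rfl

theorem exists_tendsto_mean_int {a : ℤ → ℂ} (ha : FiniteTranslates a) :
    ∃ c, Tendsto (fun p : ℕ => (2 * (p : ℂ))⁻¹ * ∑ n ∈ Finset.Icc (-(p : ℤ)) p, a n) atTop
      (𝓝 c) := by
  obtain ⟨B, hB, haB⟩ := ha.bounded
  have key := exists_tendsto_integral_of_finiteTranslates (l := atTop) (h := a)
    (ν := fun p : ℕ => ProbabilityTheory.cond Measure.count (Finset.Icc (-(p : ℤ)) p : Set ℤ))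
    (Eventually.of_forall fun p => ?_) (measurable_of_countable a) ha ?_
  · obtain ⟨c, hc⟩ := key
    -- The normalizations `2p + 1` and `2p` are asymptotically the same.
    have h1 : Tendsto (fun p : ℕ => ((2 * (p : ℂ))⁻¹ * (2 * (p : ℂ) + 1))) atTop (𝓝 1) := by
      have : Tendsto (fun p : ℕ => 1 + (2 : ℂ)⁻¹ * (p : ℂ)⁻¹) atTop (𝓝 (1 + 2⁻¹ * 0)) :=
        ((tendsto_inv_atTop_nhds_zero_nat (𝕜 := ℂ)).const_mul _).const_add 1
      rw [mul_zero, add_zero] at this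
      refine this.congr' ?_
      filter_upwards [eventually_gt_atTop 0] with p hp
      have : (p : ℂ) ≠ 0 := by exact_mod_cast hp.ne'
      field_simp
    refine ⟨1 * c, (h1.mul hc).congr fun p => ?_⟩
    have : (2 * (p : ℂ) + 1) ≠ 0 := by exact_mod_cast (2 * p).succ_ne_zero
    rw [integral_cond_Icc, mul_assoc, mul_inv_cancel_left₀ this]
  · refine ProbabilityTheory.cond_isProbabilityMeasure_of_finite ?_ ?_
    · rw [Measure.count_apply_finset, Int.card_Icc, Nat.cast_ne_zero]; omega
    · rw [Measure.count_apply_finset]; exact ENNReal.natCast_ne_top _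
  · intro s
    rw [tendsto_zero_iff_norm_tendsto_zero]
    have hlim : Tendsto (fun p : ℕ => (p : ℝ)⁻¹ * (4 * (s.natAbs * B))) atTop (𝓝 0) := by
      simpa using (tendsto_inv_atTop_nhds_zero_nat (𝕜 := ℝ)).mul_const (4 * (s.natAbs * B))
    refine squeeze_zero' (Eventually.of_forall fun _ => norm_nonneg _) ?_ hlim
    filter_upwards [eventually_gt_atTop 0] with p hp
    rw [integral_cond_Icc (fun n => a (n + s)), integral_cond_Icc a, ← mul_sub, norm_mul]
    have hn : ‖(2 * (p : ℂ) + 1)⁻¹‖ ≤ (p : ℝ)⁻¹ := by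
      rw [norm_inv, show (2 * (p : ℂ) + 1) = ((2 * p + 1 : ℕ) : ℂ) by push_cast; rfl,
        Complex.norm_natCast]
      gcongr
      linarith
    refine mul_le_mul hn ?_ (norm_nonneg _) (by positivity)
    have hmap : ∑ n ∈ Finset.Icc (-(p : ℤ)) p, a (n + s)
        = ∑ n ∈ Finset.Icc (-(p : ℤ) + s) (p + s), a n := by
      rw [← Finset.map_add_right_Icc, Finset.sum_map]; rfl
    have hsum (I J : Finset ℤ) (hJ : I ⊆ J) (hcard : J.card ≤ 2 * s.natAbs) :
        ‖∑ n ∈ I, a n‖ ≤ 2 * (s.natAbs * B) := by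
      refine (norm_sum_le_of_le I fun n _ => haB n).trans ?_
      rw [Finset.sum_const, nsmul_eq_mul]
      have : (I.card : ℝ) ≤ 2 * s.natAbs := by
        exact_mod_cast (Finset.card_le_card hJ).trans hcard
      nlinarith
    rw [hmap, ← Finset.sum_sdiff_sub_sum_sdiff]
    have c1 := hsum (Finset.Icc (-(p : ℤ) + s) (p + s) \ Finset.Icc (-(p : ℤ)) p)
      (Finset.Icc (p + 1) (p + s) ∪ Finset.Icc (-p + s) (-p - 1))
      (fun n hn => by simp only [Finset.mem_sdiff, Finset.mem_union, Finset.mem_Icc] at hn ⊢; omega)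
      ((Finset.card_union_le _ _).trans (by simp only [Int.card_Icc]; omega))
    have c2 := hsum (Finset.Icc (-(p : ℤ)) p \ Finset.Icc (-(p : ℤ) + s) (p + s))
      (Finset.Icc (p + s + 1) p ∪ Finset.Icc (-p) (-p + s - 1))
      (fun n hn => by simp only [Finset.mem_sdiff, Finset.mem_union, Finset.mem_Icc] at hn ⊢; omega)
      ((Finset.card_union_le _ _).trans (by simp only [Int.card_Icc]; omega))
    linarith [norm_sub_le (∑ n ∈ Finset.Icc (-(p : ℤ) + s) (p + s) \ Finset.Icc (-(p : ℤ)) p, a n)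
      (∑ n ∈ Finset.Icc (-(p : ℤ)) p \ Finset.Icc (-(p : ℤ) + s) (p + s), a n)]

theorem tendsto_meanReal {f g : ℝ → ℂ} (hf : f ∈ APReal) (hg : g ∈ APReal) :
    Tendsto (meanReal f g) atTop (𝓝 (innerReal f g)) :=
  tendsto_nhds_limUnder (exists_tendsto_mean_real
    (hf.1.mul (Complex.continuous_conj.comp hg.1))
    ((finiteTranslates_of_mem_APReal hf).mul (finiteTranslates_of_mem_APReal hg).conj))

theorem tendsto_meanInt {a b : ℤ → ℂ} (ha : a ∈ APInt) (hb : b ∈ APInt) :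
    Tendsto (meanInt a b) atTop (𝓝 (innerInt a b)) :=
  tendsto_nhds_limUnder (exists_tendsto_mean_int
    ((finiteTranslates_of_mem_APInt ha).mul (finiteTranslates_of_mem_APInt hb).conj))

end AlmostPeriodic

/-! ### The analysis map on almost periodic functions -/

namespace AlmostPeriodic

theorem analysis_eq (α : ℝ) (ψ f : ℝ → ℂ) (k : ℤ) :
    analysis α ψ f k = ∫ t, f (t + k * α) * starRingEnd ℂ (ψ t) := by
  rw [← integral_sub_right_eq_self _ (k * α : ℝ)]
  simp only [analysis, pairing, translate, sub_add_cancel]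

theorem integrable_mul_conj {u ψ : ℝ → ℂ} (hu : Measurable u) {C : ℝ} (hC : ∀ t, ‖u t‖ ≤ C)
    (hψ : Integrable ψ volume) : Integrable (fun t => u t * starRingEnd ℂ (ψ t)) volume :=
  (RCLike.conjCLE (K := ℂ).toContinuousLinearMap.integrable_comp hψ).bdd_mul
    hu.aestronglyMeasurable (Eventually.of_forall hC)

theorem norm_integral_mul_conj_le {u ψ : ℝ → ℂ} {C : ℝ} (hC : ∀ t, ‖u t‖ ≤ C)
    (hψ : Integrable ψ volume) : ‖∫ t, u t * starRingEnd ℂ (ψ t)‖ ≤ C * ∫ t, ‖ψ t‖ := by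
  rw [← integral_const_mul]
  refine norm_integral_le_of_norm_le (hψ.norm.const_mul C) (Eventually.of_forall fun t => ?_)
  rw [norm_mul, RCLike.norm_conj]
  exact mul_le_mul_of_nonneg_right (hC t) (norm_nonneg _)

theorem analysis_sub {α : ℝ} {ψ f g : ℝ → ℂ} (hψ : Integrable ψ volume) (hf : Measurable f)
    (hg : Measurable g) (hfb : ∃ C, ∀ t, ‖f t‖ ≤ C) (hgb : ∃ C, ∀ t, ‖g t‖ ≤ C) :
    analysis α ψ (f - g) = analysis α ψ f - analysis α ψ g := by
  obtain ⟨C, hC⟩ := hfb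
  obtain ⟨D, hD⟩ := hgb
  ext k
  simp only [Pi.sub_apply, analysis_eq, sub_mul]
  exact integral_sub (integrable_mul_conj (hf.comp (measurable_add_const _)) (fun t => hC _) hψ)
    (integrable_mul_conj (hg.comp (measurable_add_const _)) (fun t => hD _) hψ)

theorem exists_bound_of_mem_APReal {f : ℝ → ℂ} (hf : f ∈ APReal) : ∃ C, ∀ t, ‖f t‖ ≤ C :=
  let ⟨B, _, hB⟩ := (finiteTranslates_of_mem_APReal hf).bounded
  ⟨B, hB⟩

theorem analysis_mem_APInt (α : ℝ) {ψ f : ℝ → ℂ} (hψ : Integrable ψ volume) (hf : f ∈ APReal) :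
    analysis α ψ f ∈ APInt := by
  refine mem_APInt_of_finiteTranslates fun ε hε => ?_
  have hI : 0 ≤ ∫ t, ‖ψ t‖ := integral_nonneg fun _ => norm_nonneg _
  obtain ⟨C, hC⟩ := exists_bound_of_mem_APReal hf
  obtain ⟨ι, hι, c, hc⟩ := finiteTranslates_of_mem_APReal hf (ε / ((∫ t, ‖ψ t‖) + 1))
    (by positivity)
  refine ⟨ι, hι, fun k => c (k * α), fun s s' h n => ?_⟩
  have hi (k : ℤ) : Integrable (fun t => f (t + k * α) * starRingEnd ℂ (ψ t)) volume :=
    integrable_mul_conj (hf.1.measurable.comp (measurable_add_const _)) (fun t => hC _) hψ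
  rw [analysis_eq, analysis_eq, ← integral_sub (hi _) (hi _)]
  simp only [← sub_mul]
  refine (norm_integral_mul_conj_le (C := ε / ((∫ t, ‖ψ t‖) + 1)) (fun t => ?_) hψ).trans ?_
  · have := hc _ _ h (t + n * α)
    rw [show t + n * α + s * α = t + ((n + s : ℤ) : ℝ) * α by push_cast; ring,
      show t + n * α + s' * α = t + ((n + s' : ℤ) : ℝ) * α by push_cast; ring] at this
    exact this
  · rw [div_mul_eq_mul_div, div_le_iff₀ (by positivity)]
    exact mul_le_mul_of_nonneg_left (by linarith) hε.le

/-! ### Bessel bounds imply continuity -/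

/-- The translates `T_{kα} ψ` form a Bessel sequence with bound `B`, tested on bounded square
integrable functions, for which the pairing with `ψ ∈ L¹` converges absolutely. -/
def IsBesselBound (α : ℝ) (ψ : ℝ → ℂ) (B : ℝ) : Prop :=
  ∀ u : ℝ → ℂ, Measurable u → (∃ C, ∀ t, ‖u t‖ ≤ C) → MemLp u 2 volume →
    ∀ F : Finset ℤ, ∑ k ∈ F, ‖analysis α ψ u k‖ ^ 2 ≤ B * ∫ t, ‖u t‖ ^ 2

theorem re_meanReal_self (f : ℝ → ℂ) (T : ℝ) :
    (meanReal f f T).re = (2 * T)⁻¹ * ∫ t in (-T)..T, ‖f t‖ ^ 2 := by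
  have : meanReal f f T = (((2 * T)⁻¹ * ∫ t in (-T)..T, ‖f t‖ ^ 2 : ℝ) : ℂ) := by
    simp only [meanReal, Complex.mul_conj']
    push_cast
    rw [← intervalIntegral.integral_ofReal]
    push_cast
    rfl
  rw [this, Complex.ofReal_re]

theorem re_meanInt_self (a : ℤ → ℂ) (p : ℕ) :
    (meanInt a a p).re = (2 * (p : ℝ))⁻¹ * ∑ n ∈ Finset.Icc (-(p : ℤ)) p, ‖a n‖ ^ 2 := by
  have : meanInt a a p
      = (((2 * (p : ℝ))⁻¹ * ∑ n ∈ Finset.Icc (-(p : ℤ)) p, ‖a n‖ ^ 2 : ℝ) : ℂ) := by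
    simp only [meanInt, Complex.mul_conj']
    push_cast
    rfl
  rw [this, Complex.ofReal_re]

theorem tendsto_re_meanReal {f : ℝ → ℂ} (hf : f ∈ APReal) :
    Tendsto (fun T : ℝ => (2 * T)⁻¹ * ∫ t in (-T)..T, ‖f t‖ ^ 2) atTop
      (𝓝 (innerReal f f).re) := by
  simpa only [re_meanReal_self, Function.comp_def] using
    (Complex.continuous_re.tendsto _).comp (tendsto_meanReal hf hf)

theorem tendsto_re_meanInt {a : ℤ → ℂ} (ha : a ∈ APInt) :
    Tendsto (fun p : ℕ => (2 * (p : ℝ))⁻¹ * ∑ n ∈ Finset.Icc (-(p : ℤ)) p, ‖a n‖ ^ 2) atTop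
      (𝓝 (innerInt a a).re) := by
  simpa only [re_meanInt_self, Function.comp_def] using
    (Complex.continuous_re.tendsto _).comp (tendsto_meanInt ha ha)

theorem exists_nat_setIntegral_compl_le {α : ℝ} (hα : 0 < α) {ψ : ℝ → ℂ}
    (hψ : Integrable ψ volume) {η : ℝ} (hη : 0 < η) :
    ∃ R : ℕ, ∫ t in (Set.Ioc (-(R * α)) (R * α))ᶜ, ‖ψ t‖ ≤ η := by
  have hR : Tendsto (fun R : ℕ => (R : ℝ) * α) atTop atTop :=
    tendsto_natCast_atTop_atTop.atTop_mul_const hα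
  have := intervalIntegral_tendsto_integral hψ.norm (tendsto_neg_atTop_atBot.comp hR) hR
  obtain ⟨R, hR⟩ := (this.eventually (lt_mem_nhds (sub_lt_self _ hη))).exists
  refine ⟨R, ?_⟩
  simp only [Function.comp_def] at hR
  have hle : -((R : ℝ) * α) ≤ R * α := by have : 0 ≤ (R : ℝ) * α := by positivity
                                          linarith
  rw [intervalIntegral.integral_of_le hle] at hR
  have := integral_add_compl (μ := volume) (measurableSet_Ioc (a := -((R : ℝ) * α)) (b := R * α))
    hψ.norm
  linarith

/-- Truncating `f` to `[-(p + R)α, (p + R)α]` makes it square integrable and changes the first `p`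
coefficients on either side by no more than the tail of `ψ` beyond `Rα`. -/
theorem sum_norm_analysis_sq_le {α B C η : ℝ} (hα : 0 < α) {ψ f : ℝ → ℂ}
    (hψ : Integrable ψ volume) (hB : IsBesselBound α ψ B) (hf : Continuous f)
    (hC : ∀ t, ‖f t‖ ≤ C) {R : ℕ} (hR : ∫ t in (Set.Ioc (-(R * α)) (R * α))ᶜ, ‖ψ t‖ ≤ η)
    (p : ℕ) :
    ∑ k ∈ Finset.Icc (-(p : ℤ)) p, ‖analysis α ψ f k‖ ^ 2
      ≤ 2 * (B * ∫ t in (-((p + R) * α))..((p + R) * α), ‖f t‖ ^ 2)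
        + (2 * p + 1) * (2 * (C * η) ^ 2) := by
  set T : ℝ := (p + R) * α with hT
  have hT0 : 0 ≤ T := by positivity
  have hC0 : 0 ≤ C := (norm_nonneg _).trans (hC 0)
  set u : ℝ → ℂ := (Set.Ioc (-T) T).indicator f with hu
  have hum : Measurable u := hf.measurable.indicator measurableSet_Ioc
  have huC : ∀ t, ‖u t‖ ≤ C := fun t => (norm_indicator_le_norm_self f t).trans (hC t)
  have hu2 : MemLp u 2 volume := by
    rw [hu, memLp_indicator_iff_restrict measurableSet_Ioc]
    exact MemLp.of_bound hf.aestronglyMeasurable C (Eventually.of_forall hC)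
  have hnorm : ∫ t, ‖u t‖ ^ 2 = ∫ t in (-T)..T, ‖f t‖ ^ 2 := by
    rw [intervalIntegral.integral_of_le (by linarith), ← integral_indicator measurableSet_Ioc]
    refine integral_congr_ae (Eventually.of_forall fun t => ?_)
    by_cases ht : t ∈ Set.Ioc (-T) T <;> simp [hu, ht]
  have hdiff : ∀ k ∈ Finset.Icc (-(p : ℤ)) p,
      ‖analysis α ψ f k - analysis α ψ u k‖ ≤ C * η := by
    intro k hk
    have hk1 : -(p : ℝ) ≤ k := by exact_mod_cast (Finset.mem_Icc.1 hk).1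
    have hk2 : (k : ℝ) ≤ p := by exact_mod_cast (Finset.mem_Icc.1 hk).2
    have hi {v : ℝ → ℂ} (hv : Measurable v) (hvC : ∀ t, ‖v t‖ ≤ C) :
        Integrable (fun t => v (t + k * α) * starRingEnd ℂ (ψ t)) volume :=
      integrable_mul_conj (hv.comp (measurable_add_const _)) (fun t => hvC _) hψ
    rw [analysis_eq, analysis_eq, ← integral_sub (hi hf.measurable hC) (hi hum huC)]
    refine (norm_integral_le_of_norm_le
      (g := (Set.Ioc (-(R * α)) (R * α))ᶜ.indicator fun t => C * ‖ψ t‖) ?_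
      (Eventually.of_forall fun t => ?_)).trans ?_
    · exact (hψ.norm.const_mul C).indicator measurableSet_Ioc.compl
    · rw [← sub_mul, norm_mul, RCLike.norm_conj]
      by_cases ht : t ∈ Set.Ioc (-(R * α)) (R * α)
      · have hmem : t + k * α ∈ Set.Ioc (-T) T := by
          have h1 : -(p : ℝ) * α ≤ k * α := by gcongr
          have h2 : (k : ℝ) * α ≤ p * α := by gcongr
          constructor <;> rw [hT] <;> linarith [ht.1, ht.2]
        rw [hu, Set.indicator_of_mem hmem]
        simp [ht]
      · rw [Set.indicator_of_mem (show t ∈ (Set.Ioc (-(R * α)) (R * α))ᶜ from ht)]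
        refine mul_le_mul_of_nonneg_right ?_ (norm_nonneg _)
        by_cases hmem : t + k * α ∈ Set.Ioc (-T) T
        · simpa [hu, hmem] using hC0
        · simpa [hu, hmem] using hC _
    · rw [integral_indicator measurableSet_Ioc.compl, integral_const_mul]
      exact mul_le_mul_of_nonneg_left hR hC0
  have hterm : ∀ k ∈ Finset.Icc (-(p : ℤ)) p,
      ‖analysis α ψ f k‖ ^ 2 ≤ 2 * ‖analysis α ψ u k‖ ^ 2 + 2 * (C * η) ^ 2 := by
    intro k hk
    have h1 := hdiff k hk
    have h2 := norm_le_norm_add_norm_sub' (analysis α ψ f k) (analysis α ψ u k)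
    have h3 : ‖analysis α ψ f k‖ ^ 2 ≤ (‖analysis α ψ u k‖ + C * η) ^ 2 := by
      gcongr; linarith
    nlinarith [sq_nonneg (‖analysis α ψ u k‖ - C * η)]
  refine (Finset.sum_le_sum hterm).trans ?_
  rw [Finset.sum_add_distrib, ← Finset.mul_sum, Finset.sum_const, Int.card_Icc, nsmul_eq_mul,
    show ((p : ℤ) + 1 - -(p : ℤ)).toNat = 2 * p + 1 by omega]
  push_cast
  have := hB u hum ⟨C, huC⟩ hu2 (Finset.Icc (-(p : ℤ)) p)
  rw [hnorm] at this
  linarith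

theorem innerInt_analysis_le {α B : ℝ} (hα : 0 < α) {ψ f : ℝ → ℂ}
    (hψ : Integrable ψ volume) (hB : IsBesselBound α ψ B) (hf : f ∈ APReal) :
    (innerInt (analysis α ψ f) (analysis α ψ f)).re ≤ 2 * B * α * (innerReal f f).re := by
  obtain ⟨C, hC⟩ := exists_bound_of_mem_APReal hf
  have hη (η : ℝ) (hη : 0 < η) : (innerInt (analysis α ψ f) (analysis α ψ f)).re
      ≤ 2 * B * α * (innerReal f f).re + 2 * (C * η) ^ 2 := by
    obtain ⟨R, hR⟩ := exists_nat_setIntegral_compl_le hα hψ hη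
    have hT : Tendsto (fun p : ℕ => ((p : ℝ) + R) * α) atTop atTop :=
      (tendsto_atTop_add_const_right _ _ tendsto_natCast_atTop_atTop).atTop_mul_const hα
    have h1 := (tendsto_re_meanReal hf).comp hT
    have hinv := tendsto_inv_atTop_nhds_zero_nat (𝕜 := ℝ)
    have hlim : Tendsto (fun p : ℕ => 2 * B * α * (1 + R * (p : ℝ)⁻¹)
        * ((2 * (((p : ℝ) + R) * α))⁻¹ *
          ∫ t in (-(((p : ℝ) + R) * α))..(((p : ℝ) + R) * α), ‖f t‖ ^ 2)
        + (1 + 2⁻¹ * (p : ℝ)⁻¹) * (2 * (C * η) ^ 2)) atTop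
        (𝓝 (2 * B * α * (1 + R * 0) * (innerReal f f).re + (1 + 2⁻¹ * 0) * (2 * (C * η) ^ 2))) :=
      ((((hinv.const_mul (R : ℝ)).const_add 1).const_mul _).mul h1).add
        (((hinv.const_mul _).const_add 1).mul_const _)
    simp only [mul_zero, add_zero, mul_one, one_mul] at hlim
    refine le_of_tendsto_of_tendsto (tendsto_re_meanInt (analysis_mem_APInt α hψ hf)) hlim ?_
    filter_upwards [eventually_gt_atTop 0] with p hp
    have hp' : (0 : ℝ) < p := by exact_mod_cast hp
    have := sum_norm_analysis_sq_le hα hψ hB hf.1 hC hR p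
    refine (mul_le_mul_of_nonneg_left this (by positivity)).trans (le_of_eq ?_)
    have hpR : (p : ℝ) + R ≠ 0 := by positivity
    field_simp
  have hlim : Tendsto (fun η : ℝ => 2 * B * α * (innerReal f f).re + 2 * (C * η) ^ 2) (𝓝[>] 0)
      (𝓝 (2 * B * α * (innerReal f f).re + 2 * (C * 0) ^ 2)) :=
    (Continuous.tendsto (by fun_prop) 0).mono_left nhdsWithin_le_nhds
  have := ge_of_tendsto hlim (eventually_nhdsWithin_of_forall fun η h => hη η h)
  simpa using this

theorem analysisContinuous_of_isBesselBound {α B : ℝ} (hα : 0 < α) (hB0 : 0 ≤ B) {ψ : ℝ → ℂ}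
    (hψ : Integrable ψ volume) (hB : IsBesselBound α ψ B) : AnalysisContinuous α ψ := by
  intro f hf ε hε
  have hK : 0 < 2 * B * α + 1 := by positivity
  refine ⟨ε / √(2 * B * α + 1), by positivity, fun g hg h => ?_⟩
  rw [normReal, Real.sqrt_lt' (by positivity), div_pow, Real.sq_sqrt hK.le, lt_div_iff₀ hK] at h
  rw [← analysis_sub hψ hg.1.measurable hf.1.measurable (exists_bound_of_mem_APReal hg)
    (exists_bound_of_mem_APReal hf), normInt, Real.sqrt_lt' hε]
  have hle := innerInt_analysis_le hα hψ hB (sub_mem_APReal hg hf)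
  have hnn : 0 ≤ (innerReal (g - f) (g - f)).re := by
    refine ge_of_tendsto (tendsto_re_meanReal (sub_mem_APReal hg hf)) ?_
    filter_upwards [eventually_gt_atTop 0] with T hT
    exact mul_nonneg (by positivity)
      (intervalIntegral.integral_nonneg (by linarith) fun _ _ => by positivity)
  linarith

end AlmostPeriodic

/-! ### Periodization and the Wiener space -/

namespace AlmostPeriodic

open scoped ENNReal

theorem lintegral_eq_setLIntegral_tsum {P : ℝ} (hP : 0 < P) {g : ℝ → ℝ≥0∞}
    (hg : AEMeasurable g volume) :
    ∫⁻ x, g x = ∫⁻ x in Set.Ioc 0 P, ∑' k : ℤ, g (x + k * P) := by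
  have hmp (k : ℤ) : MeasurePreserving (fun x : ℝ => x + k * P) volume volume :=
    measurePreserving_add_right volume _
  have hgk (k : ℤ) : AEMeasurable (fun x => g (x + k * P)) (volume.restrict (Set.Ioc 0 P)) :=
    (hg.comp_quasiMeasurePreserving (hmp k).quasiMeasurePreserving).restrict
  rw [lintegral_tsum hgk]
  have hd : Pairwise (Function.onFun Disjoint
      fun n : ℤ => Set.Ioc ((0 : ℝ) + n • P) (0 + (n + 1) • P)) :=
    Set.pairwise_disjoint_Ioc_add_zsmul 0 P
  rw [← setLIntegral_univ, ← iUnion_Ioc_add_zsmul hP (0 : ℝ),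
    lintegral_iUnion (fun _ => measurableSet_Ioc) hd]
  refine tsum_congr fun k => ?_
  have he : MeasurableEmbedding (fun x : ℝ => x + k * P) := measurableEmbedding_addRight _
  rw [← (hmp k).setLIntegral_comp_preimage_emb he g]
  congr 2
  ext x
  simp only [Set.mem_Ioc, Set.mem_preimage, zsmul_eq_mul]
  push_cast
  constructor <;> rintro ⟨h1, h2⟩ <;> constructor <;> linarith

/-- Only boundedly many points of a lattice lie in an interval of length `1`. -/
theorem exists_tsum_floor_le {β : ℝ} (hβ : 0 < β) :
    ∃ q : ℕ, ∀ (N : ℤ → ℝ≥0∞) (t : ℝ), ∑' k : ℤ, N ⌊t + k * β⌋ ≤ q * ∑' j, N j := by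
  refine ⟨⌈1 / β⌉₊ + 1, fun N t => ?_⟩
  set q := ⌈1 / β⌉₊ + 1 with hq
  have hqβ : 1 ≤ (q : ℝ) * β := by
    have := Nat.le_ceil (1 / β)
    rw [← div_le_iff₀ hβ, hq]
    push_cast
    linarith
  have : NeZero q := ⟨by omega⟩
  -- On each residue class modulo `q` the points are at least `1` apart.
  have hinj (r : Fin q) : Function.Injective
      fun l : ℤ => ⌊t + (((Int.divModEquiv q).symm (l, r) : ℤ) : ℝ) * β⌋ := by
    refine (strictMono_int_of_lt_succ fun l => ?_).injective
    rw [← Int.add_one_le_iff, ← Int.floor_add_one]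
    refine Int.floor_le_floor ?_
    simp only [Int.divModEquiv_symm_apply]
    push_cast
    linarith
  rw [← (Int.divModEquiv q).symm.tsum_eq, ENNReal.tsum_prod', ENNReal.tsum_comm, tsum_fintype]
  refine (Finset.sum_le_card_nsmul _ _ _ fun r _ =>
    ENNReal.tsum_comp_le_tsum_of_injective (hinj r) N).trans ?_
  simp

/-- A function of the Wiener space is dominated by a summable step function. -/
theorem MemW.exists_majorant {ψ : ℝ → ℂ} (hψ : MemW ψ) :
    ∃ N : ℤ → ℝ≥0∞, ∑' j, N j ≠ ⊤ ∧ ∀ᵐ t, ‖ψ t‖ₑ ≤ N ⌊t⌋ := by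
  set M : ℤ → ℝ≥0∞ := fun k =>
    essSup (fun x : ℝ => ‖ψ (x - k)‖ₑ) (volume.restrict (Set.Icc (0 : ℝ) 1)) with hM
  refine ⟨fun j => M (-j), ?_, ?_⟩
  · have := (Equiv.neg ℤ).tsum_eq M
    simp only [Equiv.neg_apply] at this
    rw [this]
    exact hψ.2.ne
  · have h (k : ℤ) : ∀ᵐ t : ℝ, t + k ∈ Set.Icc (0 : ℝ) 1 → ‖ψ t‖ₑ ≤ M k := by
      have h1 : ∀ᵐ x : ℝ, x ∈ Set.Icc (0 : ℝ) 1 → ‖ψ (x - k)‖ₑ ≤ M k :=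
        (ae_restrict_iff' measurableSet_Icc).1 (ENNReal.ae_le_essSup _)
      filter_upwards [(measurePreserving_add_right volume (k : ℝ)).quasiMeasurePreserving.ae h1]
        with t ht ht'
      simpa using ht ht'
    filter_upwards [ae_all_iff.2 h] with t ht
    refine ht (-⌊t⌋) ⟨?_, ?_⟩ <;> push_cast
    · linarith [Int.floor_le t]
    · linarith [Int.lt_floor_add_one t]

theorem MemW.integrable {ψ : ℝ → ℂ} (hψ : MemW ψ) : Integrable ψ volume := by
  obtain ⟨N, hN, h⟩ := hψ.exists_majorant
  refine ⟨hψ.1.aestronglyMeasurable, ?_⟩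
  obtain ⟨q, hq⟩ := exists_tsum_floor_le one_pos
  have hm : Measurable fun t : ℝ => N ⌊t⌋ := (measurable_of_countable N).comp Int.measurable_floor
  calc ∫⁻ t, ‖ψ t‖ₑ ≤ ∫⁻ t, N ⌊t⌋ := lintegral_mono_ae h
    _ = ∫⁻ t in Set.Ioc (0 : ℝ) 1, ∑' k : ℤ, N ⌊t + k * 1⌋ :=
        lintegral_eq_setLIntegral_tsum one_pos hm.aemeasurable
    _ ≤ ∫⁻ t in Set.Ioc (0 : ℝ) 1, q * ∑' j, N j := lintegral_mono fun t => hq N t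
    _ < ⊤ := by
        rw [setLIntegral_const, Real.volume_Ioc]
        exact ENNReal.mul_lt_top (ENNReal.mul_lt_top (ENNReal.natCast_lt_top q) hN.lt_top)
          ENNReal.ofReal_lt_top

theorem MemW.exists_sum_translate_le {ψ : ℝ → ℂ} (hψ : MemW ψ) {α : ℝ} (hα : 0 < α) :
    ∃ K : ℝ, 0 ≤ K ∧ ∀ᵐ t : ℝ, ∀ F : Finset ℤ, ∑ k ∈ F, ‖ψ (t - k * α)‖ ≤ K := by
  obtain ⟨N, hN, h⟩ := hψ.exists_majorant
  obtain ⟨q, hq⟩ := exists_tsum_floor_le hα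
  have hK : (q : ℝ≥0∞) * ∑' j, N j ≠ ⊤ := ENNReal.mul_ne_top (ENNReal.natCast_ne_top q) hN
  refine ⟨((q : ℝ≥0∞) * ∑' j, N j).toReal, ENNReal.toReal_nonneg, ?_⟩
  have hk (k : ℤ) : ∀ᵐ t : ℝ, ‖ψ (t - k * α)‖ₑ ≤ N ⌊t - k * α⌋ :=
    (measurePreserving_sub_right volume (k * α : ℝ)).quasiMeasurePreserving.ae h
  filter_upwards [ae_all_iff.2 hk] with t ht F
  rw [← ENNReal.ofReal_le_iff_le_toReal hK,
    ENNReal.ofReal_sum_of_nonneg fun _ _ => norm_nonneg _]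
  simp only [ofReal_norm]
  calc ∑ k ∈ F, ‖ψ (t - k * α)‖ₑ ≤ ∑ k ∈ F, N ⌊t - k * α⌋ := Finset.sum_le_sum fun k _ => ht k
    _ ≤ ∑' k : ℤ, N ⌊t - k * α⌋ := ENNReal.sum_le_tsum F
    _ = ∑' k : ℤ, N ⌊t + k * α⌋ := by
        rw [← (Equiv.neg ℤ).tsum_eq fun k : ℤ => N ⌊t + k * α⌋]
        simp [sub_eq_add_neg]
    _ ≤ q * ∑' j, N j := hq N t

/-- Schur's test: Cauchy–Schwarz with respect to the weight `|ψ (t - kα)|` gives the factor `‖ψ‖₁`,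
and the sum over `k` of these weights is essentially bounded. -/
theorem MemW.exists_isBesselBound {ψ : ℝ → ℂ} (hψ : MemW ψ) {α : ℝ} (hα : 0 < α) :
    ∃ B : ℝ, 0 ≤ B ∧ IsBesselBound α ψ B := by
  obtain ⟨K, hK0, hK⟩ := hψ.exists_sum_translate_le hα
  have hi := hψ.integrable
  have hY : 0 ≤ ∫ t, ‖ψ t‖ := integral_nonneg fun _ => norm_nonneg _
  refine ⟨(∫ t, ‖ψ t‖) * K, mul_nonneg hY hK0, ?_⟩
  rintro u hum ⟨C, hC⟩ hu2 F
  have hψk (k : ℤ) : Integrable (fun t => ‖ψ (t - k * α)‖) volume :=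
    (hi.comp_sub_right (k * α : ℝ)).norm
  have h1 (k : ℤ) : Integrable (fun t => ‖u t‖ * ‖ψ (t - k * α)‖) volume :=
    (hψk k).bdd_mul hum.norm.aestronglyMeasurable (c := C)
      (Eventually.of_forall fun t => by simpa using hC t)
  have h2 (k : ℤ) : Integrable (fun t => ‖u t‖ ^ 2 * ‖ψ (t - k * α)‖) volume :=
    (hψk k).bdd_mul (hum.norm.pow_const 2).aestronglyMeasurable (c := C ^ 2)
      (Eventually.of_forall fun t => by
        simpa using pow_le_pow_left₀ (norm_nonneg _) (hC t) 2)
  have hcs (k : ℤ) : ‖analysis α ψ u k‖ ^ 2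
      ≤ (∫ t, ‖ψ t‖) * ∫ t, ‖u t‖ ^ 2 * ‖ψ (t - k * α)‖ := by
    have hX : ‖analysis α ψ u k‖ ≤ ∫ t, ‖u t‖ * ‖ψ (t - k * α)‖ :=
      norm_integral_le_of_norm_le (h1 k) (Eventually.of_forall fun t => by
        rw [norm_mul, RCLike.norm_conj, translate])
    -- The integral of `(|u| - c)² |ψ (t - kα)|` is a nonnegative quadratic polynomial in `c`.
    have hquad (c : ℝ) : 0 ≤ (∫ t, ‖ψ t‖) * (c * c)
        + (-2 * ∫ t, ‖u t‖ * ‖ψ (t - k * α)‖) * c + ∫ t, ‖u t‖ ^ 2 * ‖ψ (t - k * α)‖ := by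
      have hnn : 0 ≤ ∫ t, (‖u t‖ - c) ^ 2 * ‖ψ (t - k * α)‖ :=
        integral_nonneg fun t => by positivity
      have e : (fun t => (‖u t‖ - c) ^ 2 * ‖ψ (t - k * α)‖) = fun t =>
          (c * c) * ‖ψ (t - k * α)‖ + (-2 * c) * (‖u t‖ * ‖ψ (t - k * α)‖)
            + ‖u t‖ ^ 2 * ‖ψ (t - k * α)‖ := by
        ext t; ring
      have i1 := (hψk k).const_mul (c * c)
      have i2 := (h1 k).const_mul (-2 * c)
      have i3 : Integrable (fun t => (c * c) * ‖ψ (t - k * α)‖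
          + (-2 * c) * (‖u t‖ * ‖ψ (t - k * α)‖)) volume := i1.add i2
      rw [e, integral_add i3 (h2 k), integral_add i1 i2, integral_const_mul,
        integral_const_mul, integral_sub_right_eq_self (fun t => ‖ψ t‖)] at hnn
      linarith
    have := discrim_le_zero hquad
    rw [discrim] at this
    have := pow_le_pow_left₀ (norm_nonneg _) hX 2
    linarith
  calc ∑ k ∈ F, ‖analysis α ψ u k‖ ^ 2
      ≤ ∑ k ∈ F, (∫ t, ‖ψ t‖) * ∫ t, ‖u t‖ ^ 2 * ‖ψ (t - k * α)‖ :=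
        Finset.sum_le_sum fun k _ => hcs k
    _ = (∫ t, ‖ψ t‖) * ∫ t, ∑ k ∈ F, ‖u t‖ ^ 2 * ‖ψ (t - k * α)‖ := by
        rw [← Finset.mul_sum, integral_finsetSum F fun k _ => h2 k]
    _ ≤ (∫ t, ‖ψ t‖) * ∫ t, K * ‖u t‖ ^ 2 := by
        refine mul_le_mul_of_nonneg_left (integral_mono_ae (integrable_finsetSum F fun k _ => h2 k)
          (((memLp_two_iff_integrable_sq_norm hu2.1).1 hu2).const_mul K) ?_) hY
        filter_upwards [hK] with t ht
        rw [← Finset.mul_sum, mul_comm]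
        exact mul_le_mul_of_nonneg_right (ht F) (by positivity)
    _ = (∫ t, ‖ψ t‖) * K * ∫ t, ‖u t‖ ^ 2 := by rw [integral_const_mul, mul_assoc]

end AlmostPeriodic

/-! ### Fourier transforms of integrable functions -/

namespace AlmostPeriodic

open scoped ENNReal FourierTransform SchwartzMap ContDiff

theorem fourierT_eq (ψ : ℝ → ℂ) (x : ℝ) : fourierT ψ (2 * Real.pi * x) = 𝓕 ψ x := by
  rw [fourierT, Real.fourier_real_eq_integral_exp_smul]
  congr 1
  ext t
  rw [smul_eq_mul, mul_comm]
  congr 2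
  push_cast
  ring

theorem continuous_fourierT {ψ : ℝ → ℂ} (hψ : Integrable ψ volume) : Continuous (fourierT ψ) := by
  refine continuous_of_dominated (bound := fun t => ‖ψ t‖) (fun ξ => ?_) (fun ξ => ?_) hψ.norm ?_
  · exact hψ.1.mul (by fun_prop : Continuous fun t : ℝ =>
      Complex.exp (-(Complex.I * ξ * t))).aestronglyMeasurable
  · refine Eventually.of_forall fun t => le_of_eq ?_
    rw [norm_mul, show -(Complex.I * ξ * t) = ((-(ξ * t) : ℝ) : ℂ) * Complex.I by push_cast; ring,
      Complex.norm_exp_ofReal_mul_I, mul_one]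
  · exact Eventually.of_forall fun t => by fun_prop

theorem enorm_fourierT_le (ψ : ℝ → ℂ) (ξ : ℝ) : ‖fourierT ψ ξ‖ₑ ≤ ∫⁻ t, ‖ψ t‖ₑ := by
  refine (enorm_integral_le_lintegral_enorm _).trans (lintegral_mono fun t => le_of_eq ?_)
  rw [enorm_mul, show -(Complex.I * ξ * t) = ((-(ξ * t) : ℝ) : ℂ) * Complex.I by push_cast; ring,
    ← ofReal_norm (Complex.exp _), Complex.norm_exp_ofReal_mul_I, ENNReal.ofReal_one, mul_one]

theorem integral_fourier_mul_eq {f g : ℝ → ℂ} (hf : Integrable f volume)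
    (hg : Integrable g volume) : ∫ x, 𝓕 f x * g x = ∫ x, f x * 𝓕 g x := by
  simpa using! VectorFourier.integral_fourierIntegral_smul_eq_flip (L := innerₗ ℝ)
    Real.continuous_fourierChar continuous_inner hf hg

theorem integral_fourierInv_mul_eq {f g : ℝ → ℂ} (hf : Integrable f volume)
    (hg : Integrable g volume) : ∫ x, 𝓕⁻ f x * g x = ∫ x, f x * 𝓕⁻ g x := by
  simp only [Real.fourierInv_eq_fourier_comp_neg]
  rw [integral_fourier_mul_eq hf.comp_neg hg, ← integral_neg_eq_self]
  simp only [neg_neg, ← Real.fourierInv_eq_fourier_neg, Real.fourierInv_eq_fourier_comp_neg]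

theorem ae_eq_of_integral_schwartz_mul_eq {f g : ℝ → ℂ} (hf : LocallyIntegrable f volume)
    (hg : LocallyIntegrable g volume) (h : ∀ u : 𝓢(ℝ, ℂ), ∫ x, u x * f x = ∫ x, u x * g x) :
    f =ᵐ[volume] g := by
  refine ae_eq_of_integral_contDiff_smul_eq hf hg fun u hu hc => ?_
  have hc' : HasCompactSupport fun x => (u x : ℂ) := hc.comp_left (g := Complex.ofReal) rfl
  have hu' : ContDiff ℝ ∞ fun x => (u x : ℂ) := Complex.ofRealCLM.contDiff.comp hu
  simpa using h (hc'.toSchwartzMap hu')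

/-- Fourier inversion almost everywhere, without any continuity of `φ`. -/
theorem fourierInv_fourier_ae_eq {φ : ℝ → ℂ} (hφ : Integrable φ volume)
    (h : Integrable (𝓕 φ) volume) : 𝓕⁻ (𝓕 φ) =ᵐ[volume] φ := by
  have hc : Continuous (𝓕⁻ (𝓕 φ)) := by
    rw [show 𝓕⁻ (𝓕 φ) = fun x => 𝓕 (𝓕 φ) (-x) from
      funext fun x => Real.fourierInv_eq_fourier_neg _ _]
    exact (VectorFourier.fourierIntegral_continuous Real.continuous_fourierChar
      continuous_inner h).comp continuous_neg
  refine ae_eq_of_integral_schwartz_mul_eq hc.locallyIntegrable hφ.locallyIntegrable fun u => ?_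
  have hu : 𝓕 (𝓕⁻ u : 𝓢(ℝ, ℂ)) = u := FourierTransform.fourier_fourierInv_eq u
  have e1 := integral_fourier_mul_eq (𝓕⁻ u : 𝓢(ℝ, ℂ)).integrable hφ
  rw [← SchwartzMap.fourier_coe, hu] at e1
  rw [e1, SchwartzMap.fourierInv_coe, integral_fourierInv_mul_eq u.integrable h]

/-- An integrable function with square integrable Fourier transform is square integrable, and
Plancherel's identity holds. Its transform has a square integrable inverse transform, and the two
functions agree as tempered distributions. -/
theorem eLpNorm_two_eq_of_memLp_fourier {v : ℝ → ℂ} (hv : Integrable v volume)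
    (h : MemLp (𝓕 v) 2 volume) : eLpNorm v 2 volume = eLpNorm (𝓕 v) 2 volume := by
  set V : Lp ℂ 2 (volume : Measure ℝ) := h.toLp with hV
  set w : Lp ℂ 2 (volume : Measure ℝ) := 𝓕⁻ V with hw
  have hwv : v =ᵐ[volume] w := by
    refine ae_eq_of_integral_schwartz_mul_eq hv.locallyIntegrable
      ((Lp.memLp w).locallyIntegrable (by norm_num)) fun u => ?_
    have e1 := integral_fourier_mul_eq (𝓕⁻ u : 𝓢(ℝ, ℂ)).integrable hv
    rw [← SchwartzMap.fourier_coe, FourierTransform.fourier_fourierInv_eq u] at e1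
    have e2 := DFunLike.congr_fun (Lp.fourierInv_toTemperedDistribution_eq V) u
    rw [TemperedDistribution.fourierInv_apply, Lp.toTemperedDistribution_apply,
      Lp.toTemperedDistribution_apply] at e2
    simp only [smul_eq_mul] at e2
    rw [e1, ← e2]
    refine integral_congr_ae ?_
    filter_upwards [h.coeFn_toLp] with x hx
    rw [hV, hx]
  have hn : ‖w‖ = ‖V‖ := by
    rw [← Lp.norm_fourier_eq w, hw, FourierTransform.fourier_fourierInv_eq]
  rw [Lp.norm_def, Lp.norm_def, ENNReal.toReal_eq_toReal_iff' (Lp.eLpNorm_ne_top _)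
    (Lp.eLpNorm_ne_top _)] at hn
  rw [eLpNorm_congr_ae hwv, hn]
  exact eLpNorm_congr_ae h.coeFn_toLp

theorem lintegral_enorm_sq_eq_fourier {v : ℝ → ℂ} (hv : Integrable v volume)
    (h : ∫⁻ x, ‖𝓕 v x‖ₑ ^ 2 ≠ ⊤) : ∫⁻ x, ‖v x‖ₑ ^ 2 = ∫⁻ x, ‖𝓕 v x‖ₑ ^ 2 := by
  have key (f : ℝ → ℂ) : eLpNorm f 2 volume ^ 2 = ∫⁻ x, ‖f x‖ₑ ^ 2 := by
    have := eLpNorm_nnreal_pow_eq_lintegral (f := f) (μ := volume) (p := 2) two_ne_zero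
    simpa only [NNReal.coe_ofNat, ENNReal.coe_ofNat, ENNReal.rpow_ofNat] using this
  have hm : MemLp (𝓕 v) 2 volume := by
    refine ⟨(VectorFourier.fourierIntegral_continuous Real.continuous_fourierChar
      continuous_inner hv).aestronglyMeasurable, lt_top_iff_ne_top.2 fun htop => h ?_⟩
    rw [← key, htop]; rfl
  rw [← key, ← key, eLpNorm_two_eq_of_memLp_fourier hv hm]

/-! ### Transforms of functions of the Wiener space -/

/-- If `ψ ∈ L¹` is the Fourier transform of `φ ∈ W`, then `ψ̂` is a continuous representative of
`2π φ(-·)`, and so it inherits the summable step majorant of `φ`, now at every point. -/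
theorem iSup_tsum_lt_top_of_memWHat {α : ℝ} (hα : 0 < α) {ψ : ℝ → ℂ}
    (hψ : Integrable ψ volume) (hW : MemWHat ψ) :
    (⨆ ξ : ℝ, ∑' k : ℤ, ‖fourierT ψ (ξ + 2 * Real.pi * (k / α))‖ₑ ^ 2) < ⊤ := by
  obtain ⟨φ, hφW, hφ⟩ := hW
  have hπ := Real.pi_pos
  obtain ⟨N, hN, hφN⟩ := hφW.exists_majorant
  have hF (x : ℝ) : 𝓕 φ x = fourierT φ (2 * Real.pi * x) := (fourierT_eq φ x).symm
  have hFi : Integrable (𝓕 φ) volume := by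
    simp only [funext hF]
    exact (hψ.congr hφ).comp_mul_left' (by positivity)
  -- `𝓕` has the phase `exp(-2πitx)`; the substitution `t = 2πy` changes the normalization.
  have hinv (x : ℝ) : 𝓕⁻ (𝓕 φ) x = (2 * Real.pi : ℂ)⁻¹ * fourierT ψ (-x) := by
    have e : 𝓕⁻ (𝓕 φ) x = ∫ y : ℝ, (fun t : ℝ => fourierT φ t
        * Complex.exp (-(Complex.I * ((-x : ℝ) : ℂ) * t))) (2 * Real.pi * y) := by
      rw [Real.fourierInv_eq_fourier_neg, Real.fourier_real_eq_integral_exp_smul]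
      congr 1
      ext y
      rw [smul_eq_mul, mul_comm, hF]
      congr 2
      push_cast
      ring
    rw [e, Measure.integral_comp_mul_left (fun t : ℝ => fourierT φ t
      * Complex.exp (-(Complex.I * ((-x : ℝ) : ℂ) * t))),
      abs_of_pos (by positivity), Complex.real_smul, fourierT]
    congr 1
    · push_cast; rfl
    · refine integral_congr_ae ?_
      filter_upwards [hφ] with t ht
      rw [ht]
  have hae : ∀ᵐ t : ℝ, ‖fourierT ψ (-t)‖ₑ ≤ ENNReal.ofReal (2 * Real.pi) * N ⌊t⌋ := by
    filter_upwards [fourierInv_fourier_ae_eq hφW.integrable hFi, hφN] with t h1 h2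
    rw [hinv] at h1
    have h3 : fourierT ψ (-t) = ((2 * Real.pi : ℝ) : ℂ) * φ t := by
      rw [← h1, ← mul_assoc]
      push_cast
      rw [mul_inv_cancel₀ (by simp [hπ.ne']), one_mul]
    rw [h3, enorm_mul, ← ofReal_norm ((2 * Real.pi : ℝ) : ℂ), Complex.norm_real,
      Real.norm_of_nonneg (by positivity)]
    gcongr
  have hall (t : ℝ) : ‖fourierT ψ (-t)‖ₑ ≤ ENNReal.ofReal (2 * Real.pi) * N ⌊t⌋ := by
    -- `t` is a limit from the right of points of the dense set where the bound is known, and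
    -- the majorant is constant to the right of `t`.
    have hd := Measure.dense_of_ae hae
    have hcl : IsClosed {s : ℝ | ‖fourierT ψ (-s)‖ₑ ≤ ENNReal.ofReal (2 * Real.pi) * N ⌊t⌋} :=
      isClosed_le ((continuous_fourierT hψ).comp continuous_neg).enorm continuous_const
    have hlt : t < ⌊t⌋ + 1 := Int.lt_floor_add_one t
    have hmem : t ∈ closure (Set.Ioo t (⌊t⌋ + 1)) := by
      rw [closure_Ioo hlt.ne]; exact ⟨le_rfl, hlt.le⟩
    have hsub := closure_minimal (hd.open_subset_closure_inter isOpen_Ioo) isClosed_closure hmem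
    refine closure_minimal ?_ hcl hsub
    rintro s ⟨hs, hs'⟩
    have : ⌊s⌋ = ⌊t⌋ := Int.floor_eq_iff.2 ⟨(Int.floor_le t).trans hs.1.le, hs.2⟩
    rw [Set.mem_ofPred_eq, this] at hs'
    exact hs'
  obtain ⟨q, hq⟩ := exists_tsum_floor_le (β := 2 * Real.pi / α) (by positivity)
  refine lt_of_le_of_lt (iSup_le (a := (∫⁻ t, ‖ψ t‖ₑ) * (ENNReal.ofReal (2 * Real.pi)
    * (q * ∑' j, N j))) fun ξ => ?_) (ENNReal.mul_lt_top hψ.2 (ENNReal.mul_lt_top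
      ENNReal.ofReal_lt_top (ENNReal.mul_lt_top (ENNReal.natCast_lt_top q) hN.lt_top)))
  calc ∑' k : ℤ, ‖fourierT ψ (ξ + 2 * Real.pi * (k / α))‖ₑ ^ 2
      ≤ ∑' k : ℤ, (∫⁻ t, ‖ψ t‖ₑ) * (ENNReal.ofReal (2 * Real.pi)
          * N ⌊-ξ + (-k : ℤ) * (2 * Real.pi / α)⌋) := by
        refine ENNReal.tsum_le_tsum fun k => ?_
        rw [sq]
        refine mul_le_mul' (enorm_fourierT_le _ _) ?_
        have := hall (-ξ + (-k : ℤ) * (2 * Real.pi / α))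
        rwa [show -(-ξ + ((-k : ℤ) : ℝ) * (2 * Real.pi / α)) = ξ + 2 * Real.pi * (k / α) by
          push_cast; ring] at this
    _ = (∫⁻ t, ‖ψ t‖ₑ) * (ENNReal.ofReal (2 * Real.pi)
          * ∑' k : ℤ, N ⌊-ξ + k * (2 * Real.pi / α)⌋) := by
        rw [ENNReal.tsum_mul_left, ENNReal.tsum_mul_left,
          ← (Equiv.neg ℤ).tsum_eq fun k : ℤ => N ⌊-ξ + k * (2 * Real.pi / α)⌋]
        simp
    _ ≤ _ := by gcongr; exact hq N (-ξ)

end AlmostPeriodic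

/-! ### Trigonometric sums with frequencies in an arithmetic progression -/

namespace AlmostPeriodic

open scoped ENNReal FourierTransform

theorem intervalIntegral_norm_sq_trigSum (F : Finset ℤ) (c : ℤ → ℂ) (μ : ℝ) {ω L : ℝ}
    (hω : ω ≠ 0) (hL : Complex.exp (Complex.I * ω * L) = 1) (a : ℝ) :
    ∫ t in a..(a + L), ‖∑ k ∈ F, c k * Complex.exp (Complex.I * ((μ + k * ω : ℝ) : ℂ) * t)‖ ^ 2
      = L * ∑ k ∈ F, ‖c k‖ ^ 2 := by
  have horth (k l : ℤ) : ∫ t : ℝ in a..(a + L),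
      Complex.exp (Complex.I * (((k - l : ℤ) : ℂ) * ω) * t) = if k = l then (L : ℂ) else 0 := by
    split_ifs with h
    · subst h; simp
    · have hkl : Complex.I * (((k - l : ℤ) : ℂ) * ω) ≠ 0 := by
        have : ((k - l : ℤ) : ℂ) ≠ 0 := by exact_mod_cast sub_ne_zero.2 h
        have : (ω : ℂ) ≠ 0 := by exact_mod_cast hω
        simp_all
      rw [integral_exp_mul_complex hkl]
      have e : Complex.exp (Complex.I * (((k - l : ℤ) : ℂ) * ω) * ((a + L : ℝ) : ℂ))
          = Complex.exp (Complex.I * (((k - l : ℤ) : ℂ) * ω) * a) := by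
        rw [show Complex.I * (((k - l : ℤ) : ℂ) * ω) * ((a + L : ℝ) : ℂ)
          = Complex.I * (((k - l : ℤ) : ℂ) * ω) * a + ((k - l : ℤ) : ℂ) * (Complex.I * ω * L) by
            push_cast; ring, Complex.exp_add, Complex.exp_int_mul, hL, one_zpow, mul_one]
      rw [e, sub_self, zero_div]
  have hexp (t : ℝ) :
      ((‖∑ k ∈ F, c k * Complex.exp (Complex.I * ((μ + k * ω : ℝ) : ℂ) * t)‖ ^ 2 : ℝ) : ℂ)
      = ∑ k ∈ F, ∑ l ∈ F, c k * starRingEnd ℂ (c l)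
          * Complex.exp (Complex.I * (((k - l : ℤ) : ℂ) * ω) * t) := by
    rw [Complex.ofReal_pow, ← Complex.mul_conj', map_sum, Finset.sum_mul_sum]
    refine Finset.sum_congr rfl fun k _ => Finset.sum_congr rfl fun l _ => ?_
    rw [map_mul, ← Complex.exp_conj, mul_mul_mul_comm, ← Complex.exp_add]
    congr 2
    simp only [map_mul, Complex.conj_I, Complex.conj_ofReal]
    push_cast
    ring
  apply Complex.ofReal_injective
  rw [← intervalIntegral.integral_ofReal]
  simp only [hexp]
  have hii (k l : ℤ) : IntervalIntegrable (fun t : ℝ => c k * starRingEnd ℂ (c l)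
      * Complex.exp (Complex.I * (((k - l : ℤ) : ℂ) * ω) * t)) volume a (a + L) :=
    Continuous.intervalIntegrable (by fun_prop) _ _
  rw [intervalIntegral.integral_finsetSum fun k _ =>
    Continuous.intervalIntegrable (by fun_prop) _ _]
  simp only [intervalIntegral.integral_finsetSum fun l _ => hii _ l,
    intervalIntegral.integral_const_mul, horth, mul_ite, mul_zero]
  push_cast
  rw [Finset.mul_sum]
  refine Finset.sum_congr rfl fun k hk => ?_
  rw [Finset.sum_ite_eq, if_pos hk, Complex.mul_conj', mul_comm]

/-! ### The Fourier condition implies a Bessel bound -/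

theorem fourier_sum_translate {α : ℝ} {ψ : ℝ → ℂ} (hψ : Integrable ψ volume) (F : Finset ℤ)
    (d : ℤ → ℂ) (x : ℝ) :
    𝓕 (fun t => ∑ k ∈ F, d k * ψ (t - k * α)) x
      = (∑ k ∈ F, d k * Complex.exp (Complex.I * ((0 + k * (-(2 * Real.pi * α)) : ℝ) : ℂ) * x))
        * 𝓕 ψ x := by
  have hi (k : ℤ) : Integrable (fun t : ℝ => Complex.exp (↑(-2 * Real.pi * t * x) * Complex.I)
      * (d k * ψ (t - k * α))) volume := by
    refine ((hψ.comp_sub_right (k * α : ℝ)).const_mul (d k)).bdd_mul (c := 1)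
      (Continuous.aestronglyMeasurable (by fun_prop)) (Eventually.of_forall fun t => ?_)
    rw [Complex.norm_exp_ofReal_mul_I]
  simp only [Real.fourier_real_eq_integral_exp_smul, smul_eq_mul, Finset.mul_sum]
  rw [integral_finsetSum F fun k _ => hi k, Finset.sum_mul]
  refine Finset.sum_congr rfl fun k _ => ?_
  rw [← integral_sub_right_eq_self
    (fun t : ℝ => Complex.exp (↑(-2 * Real.pi * t * x) * Complex.I) * ψ t) (k * α : ℝ),
    ← integral_const_mul]
  congr 1
  ext t
  have : Complex.exp (↑(-2 * Real.pi * t * x) * Complex.I)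
      = Complex.exp (Complex.I * ((0 + k * (-(2 * Real.pi * α)) : ℝ) : ℂ) * x)
        * Complex.exp (↑(-2 * Real.pi * (t - k * α) * x) * Complex.I) := by
    rw [← Complex.exp_add]
    congr 1
    push_cast
    ring
  rw [this]
  ring

/-- The bound for the synthesis operator: by Plancherel the norm of `∑ d k T_{kα} ψ` is that of a
trigonometric sum of period `1 / α` times `ψ̂`, and folding the line onto one period puts the
periodization of `|ψ̂|²` in evidence. -/
theorem lintegral_sum_translate_sq_le {α : ℝ} (hα : 0 < α) {ψ : ℝ → ℂ} (hψ : Integrable ψ volume)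
    {A : ℝ≥0∞} (hA : A ≠ ⊤) (h : ∀ x : ℝ, ∑' k : ℤ, ‖𝓕 ψ (x + k * α⁻¹)‖ₑ ^ 2 ≤ A)
    (F : Finset ℤ) (d : ℤ → ℂ) :
    ∫⁻ t, ‖∑ k ∈ F, d k * ψ (t - k * α)‖ₑ ^ 2
      ≤ A * ENNReal.ofReal (α⁻¹ * ∑ k ∈ F, ‖d k‖ ^ 2) := by
  have hαi : 0 < α⁻¹ := inv_pos.2 hα
  have hv : Integrable (fun t => ∑ k ∈ F, d k * ψ (t - k * α)) volume :=
    integrable_finsetSum F fun k _ => (hψ.comp_sub_right (k * α : ℝ)).const_mul (d k)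
  set D : ℝ → ℂ := fun x =>
    ∑ k ∈ F, d k * Complex.exp (Complex.I * ((0 + k * (-(2 * Real.pi * α)) : ℝ) : ℂ) * x) with hD
  have hDc : Continuous D := by fun_prop
  have hexp : Complex.exp (Complex.I * ((-(2 * Real.pi * α) : ℝ) : ℂ) * ((α⁻¹ : ℝ) : ℂ)) = 1 := by
    rw [Complex.exp_eq_one_iff]
    refine ⟨-1, ?_⟩
    have : (α : ℂ) ≠ 0 := by exact_mod_cast hα.ne'
    push_cast
    field_simp
  have hDp (x : ℝ) (j : ℤ) : D (x + j * α⁻¹) = D x := by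
    refine Finset.sum_congr rfl fun k _ => ?_
    congr 1
    rw [show Complex.I * ((0 + k * (-(2 * Real.pi * α)) : ℝ) : ℂ) * ((x + j * α⁻¹ : ℝ) : ℂ)
      = Complex.I * ((0 + k * (-(2 * Real.pi * α)) : ℝ) : ℂ) * x + ((k * j : ℤ) : ℂ)
        * (Complex.I * ((-(2 * Real.pi * α) : ℝ) : ℂ) * ((α⁻¹ : ℝ) : ℂ)) by push_cast; ring,
      Complex.exp_add, Complex.exp_int_mul, hexp, one_zpow, mul_one]
  have hDint : ∫⁻ x in Set.Ioc 0 α⁻¹, ‖D x‖ₑ ^ 2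
      = ENNReal.ofReal (α⁻¹ * ∑ k ∈ F, ‖d k‖ ^ 2) := by
    have := intervalIntegral_norm_sq_trigSum F d 0 (ω := -(2 * Real.pi * α)) (L := α⁻¹)
      (by have := Real.pi_pos; simp [hα.ne', this.ne']) hexp 0
    rw [zero_add, intervalIntegral.integral_of_le hαi.le] at this
    rw [← this, ofReal_integral_eq_lintegral_ofReal]
    · refine lintegral_congr fun x => ?_
      rw [ENNReal.ofReal_pow (norm_nonneg _), ofReal_norm]
    · exact ((hDc.norm.pow 2).continuousOn.integrableOn_compact isCompact_Icc).mono_set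
        Set.Ioc_subset_Icc_self
    · exact Eventually.of_forall fun x => by positivity
  have hFc : Continuous (𝓕 ψ) := VectorFourier.fourierIntegral_continuous
    Real.continuous_fourierChar continuous_inner hψ
  have hle : ∫⁻ x, ‖𝓕 (fun t => ∑ k ∈ F, d k * ψ (t - k * α)) x‖ₑ ^ 2
      ≤ A * ENNReal.ofReal (α⁻¹ * ∑ k ∈ F, ‖d k‖ ^ 2) := by
    simp only [fourier_sum_translate hψ F d]
    change ∫⁻ x, ‖D x * 𝓕 ψ x‖ₑ ^ 2 ≤ _
    have hm : AEMeasurable (fun x => ‖D x * 𝓕 ψ x‖ₑ ^ 2) volume :=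
      ((hDc.mul hFc).enorm.measurable.pow_const 2).aemeasurable
    rw [lintegral_eq_setLIntegral_tsum hαi hm, ← hDint,
      ← lintegral_const_mul _ (hDc.enorm.measurable.pow_const 2)]
    refine lintegral_mono fun x => ?_
    simp only [hDp, enorm_mul, mul_pow]
    rw [ENNReal.tsum_mul_left, mul_comm]
    gcongr
    exact h x
  rwa [lintegral_enorm_sq_eq_fourier hv
    (ne_top_of_le_ne_top (ENNReal.mul_ne_top hA ENNReal.ofReal_ne_top) hle)]

theorem exists_isBesselBound_of_iSup_lt_top {α : ℝ} (hα : 0 < α) {ψ : ℝ → ℂ}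
    (hψ : Integrable ψ volume)
    (h : (⨆ ξ : ℝ, ∑' k : ℤ, ‖fourierT ψ (ξ + 2 * Real.pi * (k / α))‖ₑ ^ 2) < ⊤) :
    ∃ B : ℝ, 0 ≤ B ∧ IsBesselBound α ψ B := by
  set A := ⨆ ξ : ℝ, ∑' k : ℤ, ‖fourierT ψ (ξ + 2 * Real.pi * (k / α))‖ₑ ^ 2 with hA
  have hA' (x : ℝ) : ∑' k : ℤ, ‖𝓕 ψ (x + k * α⁻¹)‖ₑ ^ 2 ≤ A := by
    refine le_trans (le_of_eq ?_)
      (le_iSup (fun ξ : ℝ => ∑' k : ℤ, ‖fourierT ψ (ξ + 2 * Real.pi * (k / α))‖ₑ ^ 2)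
        (2 * Real.pi * x))
    refine tsum_congr fun k => ?_
    rw [← fourierT_eq]
    congr 3
    ring
  -- The bound `A / α` would do; the summand `1` makes `K` invertible.
  set K : ℝ := (A.toReal + 1) * α⁻¹ with hK
  have hK0 : 0 < K := by have := ENNReal.toReal_nonneg (a := A); positivity
  refine ⟨K, hK0.le, ?_⟩
  rintro u hum ⟨C, hC⟩ hu2 F
  set c := analysis α ψ u with hc
  set S := ∑ k ∈ F, ‖c k‖ ^ 2 with hS
  have hS0 : 0 ≤ S := Finset.sum_nonneg fun _ _ => by positivity
  set v : ℝ → ℂ := fun t => ∑ k ∈ F, c k * ψ (t - k * α) with hv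
  have hvi : Integrable v volume :=
    integrable_finsetSum F fun k _ => (hψ.comp_sub_right (k * α : ℝ)).const_mul (c k)
  have hv2 := lintegral_sum_translate_sq_le hα hψ h.ne hA' F c
  have hvint : Integrable (fun t => ‖v t‖ ^ 2) volume := by
    refine ⟨(hvi.1.norm.pow 2), ?_⟩
    refine lt_of_le_of_lt (lintegral_mono fun t => ?_)
      (lt_of_le_of_lt hv2 (ENNReal.mul_lt_top h ENNReal.ofReal_lt_top))
    rw [enorm_pow, enorm_norm]
  have hvS : ∫ t, ‖v t‖ ^ 2 ≤ K * S := by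
    rw [integral_eq_lintegral_of_nonneg_ae (Eventually.of_forall fun t => by positivity) hvint.1]
    have e : ∫⁻ t, ENNReal.ofReal (‖v t‖ ^ 2) = ∫⁻ t, ‖v t‖ₑ ^ 2 :=
      lintegral_congr fun t => by rw [ENNReal.ofReal_pow (norm_nonneg _), ofReal_norm]
    rw [e]
    refine (ENNReal.toReal_mono (ENNReal.mul_ne_top h.ne ENNReal.ofReal_ne_top) hv2).trans ?_
    rw [ENNReal.toReal_mul, ENNReal.toReal_ofReal (by positivity), ← mul_assoc]
    refine mul_le_mul_of_nonneg_right ?_ hS0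
    exact mul_le_mul_of_nonneg_right (by linarith) (by positivity)
  have huint := (memLp_two_iff_integrable_sq_norm hu2.1).1 hu2
  -- Duality: the sum of the `|c k|²` is the pairing of `u` with `v = ∑ c k T_{kα} ψ`.
  have hdual : (S : ℂ) = ∫ t, u t * starRingEnd ℂ (v t) := by
    simp only [hv, map_sum, Finset.mul_sum, map_mul]
    rw [integral_finsetSum F fun k _ => by
      simpa using integrable_mul_conj hum hC ((hψ.comp_sub_right (k * α : ℝ)).const_mul (c k)), hS]
    push_cast
    refine Finset.sum_congr rfl fun k _ => ?_
    rw [← Complex.conj_mul']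
    nth_rewrite 2 [hc]
    rw [analysis, pairing, ← integral_const_mul]
    congr 1
    ext t
    rw [translate]
    ring
  have hfin : S ≤ ∫ t, (K * ‖u t‖ ^ 2 + K⁻¹ * ‖v t‖ ^ 2) / 2 := by
    have hSn : S = ‖∫ t, u t * starRingEnd ℂ (v t)‖ := by
      rw [← hdual, Complex.norm_real, Real.norm_of_nonneg hS0]
    rw [hSn]
    refine norm_integral_le_of_norm_le
      (((huint.const_mul K).add (hvint.const_mul K⁻¹)).div_const 2)
      (Eventually.of_forall fun t => ?_)
    rw [norm_mul, RCLike.norm_conj]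
    have h1 : 0 ≤ K⁻¹ * (K * ‖u t‖ - ‖v t‖) ^ 2 := by positivity
    have h2 : K⁻¹ * (K * ‖u t‖ - ‖v t‖) ^ 2
        = K * ‖u t‖ ^ 2 + K⁻¹ * ‖v t‖ ^ 2 - 2 * (‖u t‖ * ‖v t‖) := by
      field_simp
      ring
    linarith
  rw [integral_div, integral_add (huint.const_mul K) (hvint.const_mul K⁻¹), integral_const_mul,
    integral_const_mul] at hfin
  have h3 : K⁻¹ * ∫ t, ‖v t‖ ^ 2 ≤ S := by
    rw [inv_mul_le_iff₀ hK0]; exact hvS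
  linarith

end AlmostPeriodic

/-! ### Continuity implies the Fourier condition -/

namespace AlmostPeriodic

open scoped ENNReal

theorem integrable_mul_exp {ψ : ℝ → ℂ} (hψ : Integrable ψ volume) (ξ : ℝ) :
    Integrable (fun t : ℝ => ψ t * Complex.exp (-(Complex.I * ξ * t))) volume := by
  refine hψ.mul_bdd (c := 1) (Continuous.aestronglyMeasurable (by fun_prop))
    (Eventually.of_forall fun t => ?_)
  rw [show -(Complex.I * ξ * t) = ((-(ξ * t) : ℝ) : ℂ) * Complex.I by push_cast; ring,
    Complex.norm_exp_ofReal_mul_I]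

theorem conj_exp_neg_I_mul (ξ t : ℝ) :
    starRingEnd ℂ (Complex.exp (-(Complex.I * ξ * t))) = Complex.exp (Complex.I * ξ * t) := by
  rw [← Complex.exp_conj]
  simp

/-- A trigonometric sum whose frequencies agree modulo `2π / α` is mapped to a multiple of a single
character of `ℤ`. -/
theorem analysis_trigSum {α : ℝ} (hα : 0 < α) {ψ : ℝ → ℂ} (hψ : Integrable ψ volume)
    (F : Finset ℤ) (c : ℤ → ℂ) (ξ : ℝ) (n : ℤ) :
    analysis α ψ (fun t => ∑ k ∈ F, c k
      * Complex.exp (Complex.I * ((ξ + k * (2 * Real.pi / α) : ℝ) : ℂ) * t)) n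
      = Complex.exp (((ξ * n * α : ℝ) : ℂ) * Complex.I)
        * ∑ k ∈ F, c k * starRingEnd ℂ (fourierT ψ (ξ + k * (2 * Real.pi / α))) := by
  have hα' : (α : ℂ) ≠ 0 := by exact_mod_cast hα.ne'
  have hshift (k : ℤ) (t : ℝ) :
      Complex.exp (Complex.I * ((ξ + k * (2 * Real.pi / α) : ℝ) : ℂ) * ((t + n * α : ℝ) : ℂ))
      = Complex.exp (((ξ * n * α : ℝ) : ℂ) * Complex.I)
        * Complex.exp (Complex.I * ((ξ + k * (2 * Real.pi / α) : ℝ) : ℂ) * t) := by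
    rw [← Complex.exp_add, ← Complex.exp_periodic.int_mul (-(k * n))]
    congr 1
    push_cast
    field_simp
    ring
  rw [analysis_eq]
  simp only [hshift, Finset.sum_mul, Finset.mul_sum]
  have hterm (k : ℤ) (t : ℝ) : c k * (Complex.exp (((ξ * n * α : ℝ) : ℂ) * Complex.I)
        * Complex.exp (Complex.I * ((ξ + k * (2 * Real.pi / α) : ℝ) : ℂ) * t))
        * starRingEnd ℂ (ψ t)
      = (Complex.exp (((ξ * n * α : ℝ) : ℂ) * Complex.I) * c k) * starRingEnd ℂ (ψ t
        * Complex.exp (-(Complex.I * ((ξ + k * (2 * Real.pi / α) : ℝ) : ℂ) * t))) := by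
    rw [map_mul, conj_exp_neg_I_mul]
    ring
  simp only [hterm]
  have hi (k : ℤ) : Integrable (fun t : ℝ => starRingEnd ℂ (ψ t
      * Complex.exp (-(Complex.I * ((ξ + k * (2 * Real.pi / α) : ℝ) : ℂ) * t)))) volume :=
    RCLike.conjCLE (K := ℂ).toContinuousLinearMap.integrable_comp (integrable_mul_exp hψ _)
  rw [integral_finsetSum F fun k _ => (hi k).const_mul _]
  refine Finset.sum_congr rfl fun k _ => ?_
  rw [integral_const_mul, integral_conj, mul_assoc]
  rfl

theorem re_innerReal_trigSum {α : ℝ} (hα : 0 < α) (F : Finset ℤ) (c : ℤ → ℂ) (ξ : ℝ)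
    {f : ℝ → ℂ} (hf : f ∈ APReal) (hfe : f = fun t : ℝ => ∑ k ∈ F, c k
      * Complex.exp (Complex.I * ((ξ + k * (2 * Real.pi / α) : ℝ) : ℂ) * t)) :
    (innerReal f f).re = ∑ k ∈ F, ‖c k‖ ^ 2 := by
  have hα' : (α : ℂ) ≠ 0 := by exact_mod_cast hα.ne'
  have hT : Tendsto (fun n : ℕ => (n : ℝ) * α) atTop atTop :=
    tendsto_natCast_atTop_atTop.atTop_mul_const hα
  -- Along the multiples of `α` the means are eventually constant.
  refine tendsto_nhds_unique ((tendsto_re_meanReal hf).comp hT)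
    (tendsto_const_nhds.congr' ?_)
  filter_upwards [eventually_gt_atTop 0] with n hn
  have hn' : (0 : ℝ) < n := by exact_mod_cast hn
  have hL : Complex.exp (Complex.I * ((2 * Real.pi / α : ℝ) : ℂ) * ((2 * n * α : ℝ) : ℂ)) = 1 := by
    rw [Complex.exp_eq_one_iff]
    refine ⟨2 * n, ?_⟩
    push_cast
    field_simp
  have := intervalIntegral_norm_sq_trigSum F c ξ (ω := 2 * Real.pi / α) (L := 2 * n * α)
    (by have := Real.pi_pos; positivity) hL (-(n * α))
  rw [show -((n : ℝ) * α) + 2 * n * α = n * α by ring] at this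
  simp only [Function.comp_apply, hfe]
  rw [this]
  field_simp

theorem re_innerInt_of_norm_const {a : ℤ → ℂ} (ha : a ∈ APInt) {s : ℝ} (h : ∀ n, ‖a n‖ = s) :
    (innerInt a a).re = s ^ 2 := by
  refine tendsto_nhds_unique (tendsto_re_meanInt ha) ?_
  have : Tendsto (fun p : ℕ => s ^ 2 * (1 + (2 : ℝ)⁻¹ * (p : ℝ)⁻¹)) atTop
      (𝓝 (s ^ 2 * (1 + 2⁻¹ * 0))) :=
    (((tendsto_inv_atTop_nhds_zero_nat (𝕜 := ℝ)).const_mul _).const_add 1).const_mul _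
  rw [mul_zero, add_zero, mul_one] at this
  refine this.congr' ?_
  filter_upwards [eventually_gt_atTop 0] with p hp
  have hp' : (0 : ℝ) < p := by exact_mod_cast hp
  simp only [h, Finset.sum_const, Int.card_Icc, nsmul_eq_mul]
  rw [show ((p : ℤ) + 1 - -(p : ℤ)).toNat = 2 * p + 1 by omega]
  push_cast
  field_simp

/-- Testing continuity at `0` on a small multiple of `∑ ψ̂(λₖ) exp(iλₖt)`, where the `λₖ` agree modulo
`2π / α`. If `s = ∑ |ψ̂(λₖ)|²`, then this sum has norm `√s` and its image has norm `s`. -/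
theorem iSup_lt_top_of_analysisContinuous {α : ℝ} (hα : 0 < α) {ψ : ℝ → ℂ}
    (hψ : Integrable ψ volume) (h : AnalysisContinuous α ψ) :
    (⨆ ξ : ℝ, ∑' k : ℤ, ‖fourierT ψ (ξ + 2 * Real.pi * (k / α))‖ₑ ^ 2) < ⊤ := by
  obtain ⟨δ, hδ, hcont⟩ := h (fun _ => 0) (const_mem_APReal 0) 1 one_pos
  have hS0 : analysis α ψ (fun _ => 0) = 0 := by ext k; simp [analysis_eq]
  have hbound (ξ : ℝ) (F : Finset ℤ) :
      ∑ k ∈ F, ‖fourierT ψ (ξ + k * (2 * Real.pi / α))‖ ^ 2 ≤ 4 / δ ^ 2 := by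
    set s := ∑ k ∈ F, ‖fourierT ψ (ξ + k * (2 * Real.pi / α))‖ ^ 2 with hs
    have hs0 : 0 ≤ s := Finset.sum_nonneg fun _ _ => by positivity
    rcases hs0.eq_or_lt with h0 | hpos
    · rw [← h0]; positivity
    -- The factor `r` makes the norm of the test function equal to `δ / 2`.
    set r : ℝ := δ / (2 * √s) with hr
    have hr0 : 0 < r := by positivity
    set f : ℝ → ℂ := fun t => ∑ k ∈ F, (r * fourierT ψ (ξ + k * (2 * Real.pi / α)))
      * Complex.exp (Complex.I * ((ξ + k * (2 * Real.pi / α) : ℝ) : ℂ) * t) with hf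
    have hfm : f ∈ APReal :=
      sum_mem_APReal F fun k _ => mul_mem_APReal (const_mem_APReal _) (exp_mem_APReal _)
    have hnf : normReal f = δ / 2 := by
      rw [normReal, re_innerReal_trigSum hα F _ ξ hfm hf]
      simp only [norm_mul, mul_pow, Complex.norm_real, Real.norm_of_nonneg hr0.le]
      rw [← Finset.mul_sum, ← hs, Real.sqrt_mul (by positivity), Real.sqrt_sq hr0.le, hr]
      have : √s ≠ 0 := by positivity
      field_simp
    have hnS (n : ℤ) : ‖analysis α ψ f n‖ = r * s := by
      rw [hf, analysis_trigSum hα hψ, norm_mul, Complex.norm_exp_ofReal_mul_I, one_mul]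
      have : ∑ k ∈ F, (r * fourierT ψ (ξ + k * (2 * Real.pi / α)))
          * starRingEnd ℂ (fourierT ψ (ξ + k * (2 * Real.pi / α))) = ((r * s : ℝ) : ℂ) := by
        simp only [mul_assoc, Complex.mul_conj', ← Finset.mul_sum]
        rw [hs]
        push_cast
        rfl
      rw [this, Complex.norm_real, Real.norm_of_nonneg (by positivity)]
    have h1 := hcont f hfm (by
      rw [show f - (fun _ => 0) = f from sub_zero f, hnf]; linarith)
    rw [hS0, sub_zero, normInt, re_innerInt_of_norm_const (analysis_mem_APInt α hψ hfm) hnS,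
      Real.sqrt_sq (by positivity)] at h1
    have h2 : δ * √s < 2 := by
      have : r * s = δ * √s / 2 := by
        have h3 := Real.mul_self_sqrt hs0
        have h4 : √s ≠ 0 := by positivity
        rw [hr]
        field_simp
        nlinarith
      linarith
    rw [le_div_iff₀ (by positivity)]
    have h5 : (δ * √s) ^ 2 ≤ 2 ^ 2 := by gcongr
    rw [mul_pow, Real.sq_sqrt hs0] at h5
    linarith
  refine lt_of_le_of_lt (iSup_le (a := ENNReal.ofReal (4 / δ ^ 2)) fun ξ => ?_)
    ENNReal.ofReal_lt_top
  refine ENNReal.summable.tsum_le_of_sum_le fun F => ?_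
  refine le_trans (le_of_eq ?_) (ENNReal.ofReal_le_ofReal (hbound ξ F))
  rw [ENNReal.ofReal_sum_of_nonneg fun _ _ => by positivity]
  refine Finset.sum_congr rfl fun k _ => ?_
  rw [ENNReal.ofReal_pow (norm_nonneg _), ofReal_norm]
  congr 3
  ring

theorem analysisContinuous_iff {α : ℝ} (hα : 0 < α) {ψ : ℝ → ℂ} (hψ : Integrable ψ volume) :
    AnalysisContinuous α ψ ↔
      (⨆ ξ : ℝ, ∑' k : ℤ, ‖fourierT ψ (ξ + 2 * Real.pi * (k / α))‖ₑ ^ 2) < ⊤ :=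
  ⟨iSup_lt_top_of_analysisContinuous hα hψ, fun h =>
    let ⟨_, hB0, hB⟩ := exists_isBesselBound_of_iSup_lt_top hα hψ h
    analysisContinuous_of_isBesselBound hα hB0 hψ hB⟩

end AlmostPeriodic

theorem mainTheorem3 (α : ℝ) (hα : 0 < α) :
    -- the limits that define the two inner products exist
    (∀ f ∈ AlmostPeriodic.APReal, ∀ g ∈ AlmostPeriodic.APReal,
      Tendsto (AlmostPeriodic.meanReal f g) atTop (𝓝 (AlmostPeriodic.innerReal f g))) ∧
    (∀ a ∈ AlmostPeriodic.APInt, ∀ b ∈ AlmostPeriodic.APInt,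
      Tendsto (AlmostPeriodic.meanInt a b) atTop (𝓝 (AlmostPeriodic.innerInt a b))) ∧
    -- the analysis map is well defined, and its continuity is characterized
    (∀ ψ : ℝ → ℂ, Integrable ψ volume →
      (∀ f ∈ AlmostPeriodic.APReal, AlmostPeriodic.analysis α ψ f ∈ AlmostPeriodic.APInt) ∧
      (AlmostPeriodic.AnalysisContinuous α ψ ↔
        (⨆ ξ : ℝ, ∑' k : ℤ, ‖AlmostPeriodic.fourierT ψ (ξ + 2 * Real.pi * (k / α))‖ₑ ^ 2) < ⊤)) ∧
    -- the two particular cases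
    (∀ ψ : ℝ → ℂ, AlmostPeriodic.MemW ψ →
      Integrable ψ volume ∧ AlmostPeriodic.AnalysisContinuous α ψ) ∧
    (∀ ψ : ℝ → ℂ, Integrable ψ volume → AlmostPeriodic.MemWHat ψ →
      AlmostPeriodic.AnalysisContinuous α ψ) := by
  refine ⟨fun f hf g hg => AlmostPeriodic.tendsto_meanReal hf hg,
    fun a ha b hb => AlmostPeriodic.tendsto_meanInt ha hb,
    fun ψ hψ => ⟨fun f hf => AlmostPeriodic.analysis_mem_APInt α hψ hf,
      AlmostPeriodic.analysisContinuous_iff hα hψ⟩,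
    fun ψ hψ => ⟨hψ.integrable, ?_⟩,
    fun ψ hψ hW => (AlmostPeriodic.analysisContinuous_iff hα hψ).2
      (AlmostPeriodic.iSup_tsum_lt_top_of_memWHat hα hψ hW)⟩
  obtain ⟨B, hB0, hB⟩ := hψ.exists_isBesselBound hα
  exact AlmostPeriodic.analysisContinuous_of_isBesselBound hα hB0 hψ.integrable hB
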